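/- Let $S=\mathbb R/2\pi\mathbb Z$, let $k\ge 2$ be an integer, and let $C^k(S)$ be the Banach space of $2\pi$-periodic real $C^k$ functions with the norm $\|f\|=\max_{0\le j\le k}\sup_x|f^{(j)}(x)|$. For $f\in C^k(S)$ and $r,a\in\mathbb R$ let $F_{r,a}:S\to S$, $F_{r,a}(x)=x+2\pi r+af(x) \pmod{2\pi}$. For a circle map $g$ let $N(g)\in\{0,1,\dots,\infty\}$ be the number of its attracting (i.e. asymptotically stable) periodic trajectories, and let $\rho(g)$ be its rotation number, taken modulo $1$ and normalised so that the rotation $x\mapsto x+2\pi r$ has rotation number $r$. For $\rho_0\in\mathbb R$ put $$B(F,\rho_0)=\limsup_{a_1\to0+}\ \sup_{r,a\in\mathbb R:\ \rho(F_{r,a})=\rho_0,\ |a|<a_1}N(F_{r,a}).$$ The family $F$ has *finite infinitesimal cyclicity* if there is $N\in\mathbb N$ with $B(F,\rho_0)\le N$ for all $\rho_0\in\mathbb R$, and *infinite infinitesimal cyclicity* otherwise. A subset $E$ of a separable Banach space $X$ is *Haar null* (shy) if $E$ is Borel and there is a Borel probability measure $\mu$ on $X$ with $\mu(x+E)=0$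 for all $x\in X$; the complement of a Haar null set is called *Haar prevalent*. **Theorem.** For every integer $k\ge2$, the set of $f\in C^k(S)$ whose family $F_{r,a}$ has infinite infinitesimal cyclicity is Haar prevalent; that is, the set of $f\in C^k(S)$ whose family has finite infinitesimal cyclicity is Haar null. -/

import Mathlib

open Filter Topology MeasureTheory Function

namespace CircleFamily

noncomputable section

/-- The circle `S = ℝ / 2πℤ`. -/
abbrev S : Type := AddCircle (2 * Real.pi)

instance instFactTwoPiPos : Fact (0 < 2 * Real.pi) := Fact.mk Real.two_pi_pos

/-! ### The Banach space of `C^k` functions on the circle -/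

/-- The real vector space of `2π`-periodic `C^k` functions `ℝ → ℝ`. -/
def CkSubmodule (k : ℕ) : Submodule ℝ (ℝ → ℝ) where
  carrier := {f | ContDiff ℝ (k : ℕ∞) f ∧ Periodic f (2 * Real.pi)}
  add_mem' hf hg := ⟨hf.1.add hg.1, hf.2.add hg.2⟩
  zero_mem' := ⟨contDiff_const, fun _ => rfl⟩
  smul_mem' c _ hf := ⟨contDiff_const.smul hf.1, hf.2.smul c⟩

/-- `C^k(S)`: real `C^k` functions on the circle, seen as `2π`-periodic functions. -/
def Ck (k : ℕ) : Type := CkSubmodule k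

namespace Ck

variable {k : ℕ}

instance instAddCommGroup : AddCommGroup (Ck k) :=
  inferInstanceAs (AddCommGroup (CkSubmodule k))

instance instModule : Module ℝ (Ck k) :=
  inferInstanceAs (Module ℝ (CkSubmodule k))

/-- The underlying function on the real line. -/
def toFun (f : Ck k) : ℝ → ℝ := Subtype.val (p := fun g => g ∈ CkSubmodule k) f

instance instCoeFun : CoeFun (Ck k) (fun _ => ℝ → ℝ) := ⟨toFun⟩

theorem contDiff (f : Ck k) : ContDiff ℝ (k : ℕ∞) (f : ℝ → ℝ) := f.2.1

theorem periodic (f : Ck k) : Periodic (f : ℝ → ℝ) (2 * Real.pi) := f.2.2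

theorem periodic_iteratedDeriv (f : Ck k) (j : ℕ) :
    Periodic (iteratedDeriv j (f : ℝ → ℝ)) (2 * Real.pi) := by
  intro x
  have h : (fun y : ℝ => (f : ℝ → ℝ) (y + 2 * Real.pi)) = (f : ℝ → ℝ) := funext f.periodic
  have h2 := congrFun (iteratedDeriv_comp_add_const j (f : ℝ → ℝ) (2 * Real.pi)) x
  rw [h] at h2
  exact h2.symm

/-- The value of `f` at a point of the circle. -/
def onCircle (f : Ck k) : S → ℝ := f.periodic.lift

/-- The `j`-th derivative of `f`, `j ≤ k`, as a continuous function on the circle. -/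
def derivOn (f : Ck k) (j : Fin (k + 1)) : C(S, ℝ) where
  toFun := (f.periodic_iteratedDeriv j).lift
  continuous_toFun := by
    refine continuous_quot_lift _ ?_
    refine f.contDiff.continuous_iteratedDeriv j ?_
    exact_mod_cast Nat.lt_succ_iff.mp j.2

/-- All derivatives of order at most `k`, as a linear map into a product of copies of `C(S, ℝ)`. -/
def derivs (k : ℕ) : Ck k →ₗ[ℝ] (Fin (k + 1) → C(S, ℝ)) where
  toFun f := f.derivOn
  map_add' f g := by
    ext j x
    induction x using QuotientAddGroup.induction_on with
    | H x =>
      have hj : ((j : ℕ) : WithTop ℕ∞) ≤ ((k : ℕ∞) : WithTop ℕ∞) := by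
        exact_mod_cast Nat.lt_succ_iff.mp j.2
      exact iteratedDeriv_add (f.contDiff.of_le hj).contDiffAt (g.contDiff.of_le hj).contDiffAt
  map_smul' c f := by
    ext j x
    induction x using QuotientAddGroup.induction_on with
    | H x =>
      have hj : ((j : ℕ) : WithTop ℕ∞) ≤ ((k : ℕ∞) : WithTop ℕ∞) := by
        exact_mod_cast Nat.lt_succ_iff.mp j.2
      exact iteratedDeriv_const_smul (f.contDiff.of_le hj).contDiffAt c

theorem derivs_injective (k : ℕ) : Injective (derivs k) := by
  intro f g h
  refine Subtype.ext (funext fun x => ?_)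
  have h0 := congrArg (fun F : Fin (k + 1) → C(S, ℝ) => F 0 (x : S)) h
  have h1 : iteratedDeriv 0 (f : ℝ → ℝ) x = iteratedDeriv 0 (g : ℝ → ℝ) x := h0
  rw [iteratedDeriv_zero, iteratedDeriv_zero] at h1
  exact h1

/-- The `C^k` norm `‖f‖ = max_{j ≤ k} sup_x |f⁽ʲ⁾(x)|`. -/
instance instNormedAddCommGroup : NormedAddCommGroup (Ck k) :=
  NormedAddCommGroup.induced (Ck k) (Fin (k + 1) → C(S, ℝ)) (derivs k) (derivs_injective k)

instance instNormedSpace : NormedSpace ℝ (Ck k) :=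
  NormedSpace.induced ℝ (Ck k) (Fin (k + 1) → C(S, ℝ)) (derivs k)

instance instMeasurableSpace : MeasurableSpace (Ck k) := borel (Ck k)

instance instBorelSpace : BorelSpace (Ck k) := ⟨rfl⟩

end Ck

/-! ### Haar null and Haar prevalent sets -/

/-- A Borel set `E` is Haar null if some Borel probability measure vanishes on all its
translates. -/
def IsHaarNull {X : Type*} [NormedAddCommGroup X] [MeasurableSpace X] [BorelSpace X]
    (E : Set X) : Prop :=
  MeasurableSet E ∧
    ∃ μ : Measure X, IsProbabilityMeasure μ ∧ ∀ x : X, μ ((fun y => x + y) '' E) = 0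

/-- Complements of Haar null sets. -/
def IsHaarPrevalent {X : Type*} [NormedAddCommGroup X] [MeasurableSpace X] [BorelSpace X]
    (P : Set X) : Prop :=
  IsHaarNull Pᶜ

/-! ### Rotation numbers and attracting periodic trajectories -/

/-- `ρ` is a rotation number of the circle map `g`: for some lift `G : ℝ → ℝ` of degree one,
`(Gⁿ(x) - x) / (2π n) → ρ` for all `x`. The lift is not fixed, so `ρ` is a real
representative of the rotation number modulo `1`; the rotation by `2π r` has rotation number
`r`. -/
def HasRotationNumber (g : S → S) (ρ : ℝ) : Prop :=
  ∃ G : ℝ → ℝ, Continuous G ∧ (∀ x, G (x + 2 * Real.pi) = G x + 2 * Real.pi) ∧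
    (∀ x : ℝ, ((G x : ℝ) : S) = g (x : S)) ∧
    ∀ x : ℝ, Tendsto (fun n : ℕ => (G^[n] x - x) / (2 * Real.pi * n)) atTop (𝓝 ρ)

/-- The set `O` is a periodic trajectory of `g`. -/
def IsPeriodicTrajectory (g : S → S) (O : Set S) : Prop :=
  ∃ x ∈ periodicPts g, O = Set.range (fun n : ℕ => g^[n] x)

/-- The invariant set `O` is (asymptotically) attracting: trajectories that start near `O` stay
near `O`, and converge to `O`. -/
def IsAttracting (g : S → S) (O : Set S) : Prop :=
  (∀ U ∈ 𝓝ˢ O, ∀ᶠ y in 𝓝ˢ O, ∀ n : ℕ, g^[n] y ∈ U) ∧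
    ∀ᶠ y in 𝓝ˢ O, Tendsto (fun n : ℕ => g^[n] y) atTop (𝓝ˢ O)

/-- `N(g)`: the number of attracting periodic trajectories of `g`, possibly infinite. -/
def numAttracting (g : S → S) : ℕ∞ :=
  {O : Set S | IsPeriodicTrajectory g O ∧ IsAttracting g O}.encard

/-! ### Infinitesimal cyclicity -/

/-- `B(F, ρ)`, the limit superior as `a₁ → 0+` of the supremum of `N(F_{r,a})` over all real
`r`, `a` with `|a| < a₁` and `ρ(F_{r,a}) = ρ`. -/
def cyclicityAt (F : ℝ → ℝ → S → S) (ρ : ℝ) : ℕ∞ :=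
  limsup (fun a₁ : ℝ =>
    ⨆ (r : ℝ) (a : ℝ) (_ : HasRotationNumber (F r a) ρ) (_ : |a| < a₁), numAttracting (F r a))
    (𝓝[>] (0 : ℝ))

/-- The corresponding family `F_{r,a} : x ↦ x + 2π r + a f(x) (mod 2π)`. -/
def family {k : ℕ} (f : Ck k) (r a : ℝ) (x : S) : S :=
  x + ((2 * Real.pi * r + a * f.onCircle x : ℝ) : S)

/-- Functions whose family has infinitesimal cyclicity bounded by `N`. -/
def ICBounded (k N : ℕ) : Set (Ck k) :=
  {f | ∀ ρ : ℝ, cyclicityAt (family f) ρ ≤ (N : ℕ∞)}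

/-- Functions whose family has finite infinitesimal cyclicity. -/
def ICFin (k : ℕ) : Set (Ck k) := ⋃ N : {N : ℕ // 1 ≤ N}, ICBounded k N

/-- Functions whose family has infinite infinitesimal cyclicity. -/
def ICInf (k : ℕ) : Set (Ck k) := (ICFin k)ᶜ

end

end CircleFamily

namespace CircleFamily

noncomputable section

/-! Take the random function `h = ∑ᵢ 2⁻ⁱ Mᵢ⁻ᵏ cos(Mᵢ x)` with `Mᵢ = (i + 1) Qᵢ` and `Qᵢ` drawn from
a sparse sequence of integer blocks. Its law is the measure that vanishes on every translate: for
each fixed `g`, the sum `g + h` almost surely has infinite infinitesimal cyclicity.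

Near `a = 0`, at rotation number `1/q`, the displacement of the `q`-th iterate is `a` times the sum
of `f` over the `q` translates by `2π/q`, up to a constant and `o(a)`. Such a sum keeps only the
Fourier modes divisible by `q`. If `q = Qⱼ`, the earlier terms of `h` vanish from it, the `j`-th
term survives with `j + 1` oscillations per period `2π/q`, and the later terms are small. So there
are `j + 1` attracting orbits for suitable small `a`, provided `g` does not interfere
(`not_cyclicityAt_lacunary_le`). The averages of `g` are controlled by the square-summable Fourier
coefficients of its `k`-th derivative, so only few `q` are bad (`exists_card_le`). Their proportion
in block `j` tends to `0` (`volume_icBounded_eq_zero`).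

The set must also be Borel. Having `n` attracting orbits is not an open condition, so it is replaced
by the existence of `n` separated sign changes of the displacement, which is open. Attracting orbits
give such sign changes (`exists_hasCrossings`). Conversely, sign changes give attracting orbits
after an arbitrarily small change of `r`, by a Sard argument (`HasCrossings.exists_numAttracting`).
-/

/-- The lift `x ↦ x + 2πr + a f(x)` of `family f r a`. -/
def familyLift {k : ℕ} (f : Ck k) (r a : ℝ) (x : ℝ) : ℝ := x + (2 * Real.pi * r + a * f x)

/-! ### Bounds and continuity in the `C^k` norm. -/

namespace Ck

variable {k : ℕ}

theorem norm_derivOn_le (f : Ck k) (j : Fin (k + 1)) : ‖f.derivOn j‖ ≤ ‖f‖ :=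
  norm_le_pi_norm (derivs k f) j

theorem abs_iteratedDeriv_le (f : Ck k) (j : ℕ) (hj : j ≤ k) (x : ℝ) :
    |iteratedDeriv j (f : ℝ → ℝ) x| ≤ ‖f‖ :=
  ((f.derivOn ⟨j, Nat.lt_succ_of_le hj⟩).norm_coe_le_norm (x : S)).trans (f.norm_derivOn_le _)

theorem abs_deriv_le (hk : 1 ≤ k) (f : Ck k) (x : ℝ) : |deriv (f : ℝ → ℝ) x| ≤ ‖f‖ := by
  have h := f.abs_iteratedDeriv_le 1 hk x
  rwa [iteratedDeriv_one] at h

theorem norm_le_of_forall (f : Ck k) {C : ℝ} (hC : 0 ≤ C)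
    (h : ∀ j ≤ k, ∀ x, |iteratedDeriv j (f : ℝ → ℝ) x| ≤ C) : ‖f‖ ≤ C := by
  refine (pi_norm_le_iff_of_nonneg (x := derivs k f) hC).2 fun j => ?_
  refine (ContinuousMap.norm_le _ hC).2 fun x => ?_
  induction x using QuotientAddGroup.induction_on with
  | H x => exact h j (Nat.lt_succ_iff.mp j.2) x

theorem differentiable (hk : 1 ≤ k) (f : Ck k) : Differentiable ℝ (f : ℝ → ℝ) :=
  f.contDiff.differentiable (by
    have : (k : ℕ∞) ≠ 0 := by exact_mod_cast (by omega : k ≠ 0)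
    exact_mod_cast this)

theorem continuous_derivs (k : ℕ) : Continuous (derivs k) := continuous_induced_dom

theorem continuous_eval : Continuous fun p : Ck k × ℝ => (p.1 : ℝ → ℝ) p.2 := by
  have h : Continuous fun p : Ck k × ℝ => (derivs k p.1 0 : C(S, ℝ)) (p.2 : S) := by
    have h1 : Continuous fun p : Ck k × ℝ => (derivs k p.1 0 : C(S, ℝ)) :=
      (continuous_apply 0).comp ((continuous_derivs k).comp continuous_fst)
    have h2 : Continuous fun p : Ck k × ℝ => (p.2 : S) :=
      (AddCircle.continuous_mk' _).comp continuous_snd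
    exact h1.eval h2
  refine h.congr fun p => ?_
  change iteratedDeriv 0 (p.1 : ℝ → ℝ) p.2 = _
  rw [iteratedDeriv_zero]

end Ck

/-! ### Lifts of the family and their dependence on the parameters. -/

section Lift

variable {k : ℕ}

theorem continuous_familyLift_iterate (j : ℕ) :
    Continuous fun p : (Ck k × ℝ × ℝ) × ℝ => (familyLift p.1.1 p.1.2.1 p.1.2.2)^[j] p.2 := by
  induction j with
  | zero => exact continuous_snd
  | succ j ih =>
    simp only [iterate_succ_apply']
    unfold familyLift at ih ⊢
    have h : Continuous fun p : (Ck k × ℝ × ℝ) × ℝ => (p.1.1 : ℝ → ℝ)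
        ((fun x => x + (2 * Real.pi * p.1.2.1 + p.1.2.2 * p.1.1 x))^[j] p.2) :=
      Ck.continuous_eval.comp ((continuous_fst.comp continuous_fst).prodMk ih)
    fun_prop

theorem familyLift_add (f : Ck k) (r a x : ℝ) :
    familyLift f r a (x + 2 * Real.pi) = familyLift f r a x + 2 * Real.pi := by
  unfold familyLift
  rw [f.periodic]
  ring

theorem coe_familyLift (f : Ck k) (r a x : ℝ) :
    ((familyLift f r a x : ℝ) : S) = family f r a (x : S) := rfl

theorem continuous_familyLift (f : Ck k) (r a : ℝ) : Continuous (familyLift f r a) := by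
  have := f.contDiff.continuous
  unfold familyLift
  fun_prop

theorem differentiable_familyLift (hk : 1 ≤ k) (f : Ck k) (r a : ℝ) :
    Differentiable ℝ (familyLift f r a) := by
  have := f.differentiable hk
  unfold familyLift
  fun_prop

theorem strictMono_familyLift (hk : 1 ≤ k) (f : Ck k) {a : ℝ} (ha : |a| * ‖f‖ < 1) (r : ℝ) :
    StrictMono (familyLift f r a) := by
  refine strictMono_of_deriv_pos fun x => ?_
  have h : HasDerivAt (familyLift f r a) (1 + a * deriv f x) x := by
    have h1 := ((f.differentiable hk x).hasDerivAt.const_mul a).const_add (2 * Real.pi * r)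
    exact (hasDerivAt_id x).add h1
  rw [h.deriv]
  have h2 : |a * deriv f x| ≤ |a| * ‖f‖ := by
    rw [abs_mul]
    exact mul_le_mul_of_nonneg_left (f.abs_deriv_le hk x) (abs_nonneg a)
  linarith [neg_abs_le (a * deriv f x)]

/-- The last of the `q` steps already contributes the full shift `2π(s - r)`, and monotonicity
preserves the gain from the earlier ones. This linear growth in the parameter drives the Sard
argument below. -/
theorem familyLift_iterate_add_le (hk : 1 ≤ k) (f : Ck k) {a : ℝ} (ha : |a| * ‖f‖ < 1) {r s : ℝ}
    (hrs : r ≤ s) (x : ℝ) {q : ℕ} (hq : 0 < q) :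
    (familyLift f r a)^[q] x + 2 * Real.pi * (s - r) ≤ (familyLift f s a)^[q] x := by
  have hpi := Real.two_pi_pos
  have key : ∀ y, familyLift f s a y = familyLift f r a y + 2 * Real.pi * (s - r) := by
    intro y
    unfold familyLift
    ring
  induction q, hq using Nat.le_induction with
  | base => simpa using (key x).ge
  | succ q _ ih =>
    rw [iterate_succ_apply', iterate_succ_apply', ← key]
    refine (strictMono_familyLift hk f ha s).monotone ?_
    nlinarith

end Lift

/-! ### Crossings of the displacement as an open condition. -/

/-- The displacement `G^q - id - 2πp` changes sign from positive at `u` to negative at `v`. -/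
structure IsCrossing (G : ℝ → ℝ) (p : ℤ) (q : ℕ) (u v : ℝ) : Prop where
  lt : u < v
  left : u + 2 * Real.pi * p < G^[q] u
  right : G^[q] v < v + 2 * Real.pi * p

/-- The first `q` images of `[uᵢ, vᵢ]` are disjoint from the other intervals modulo `2π`. -/
def Separated (G : ℝ → ℝ) (q : ℕ) {n : ℕ} (u v : Fin n → ℝ) : Prop :=
  ∀ i i', i ≠ i' → ∀ j ∈ Set.Iio q, ∃ l : ℤ,
    v i' + 2 * Real.pi * (l - 1) < G^[j] (u i) ∧ G^[j] (v i) < u i' + 2 * Real.pi * l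

/-- There are `n` separated crossings of `G^q - 2πp`. -/
def HasCrossings (G : ℝ → ℝ) (n : ℕ) (p : ℤ) (q : ℕ) : Prop :=
  0 < q ∧ ∃ u v : Fin n → ℝ, (∀ i, IsCrossing G p q (u i) (v i)) ∧ Separated G q u v

theorem Separated.eventually {α : Type*} {L : Filter α} {Γ : α → ℝ → ℝ} {G : ℝ → ℝ} {q n : ℕ}
    {u v : Fin n → ℝ} (h : Separated G q u v)
    (hΓ : ∀ j x, Tendsto (fun t => (Γ t)^[j] x) L (𝓝 (G^[j] x))) :
    ∀ᶠ t in L, Separated (Γ t) q u v := by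
  unfold Separated
  simp only [eventually_all]
  intro i i' hi
  rw [eventually_all_finite (Set.finite_Iio q)]
  intro j hj
  obtain ⟨l, h1, h2⟩ := h i i' hi j hj
  filter_upwards [(hΓ j (u i)).eventually_const_lt h1, (hΓ j (v i)).eventually_lt_const h2]
    with t h3 h4 using ⟨l, h3, h4⟩

/-- For fixed endpoints and `q`, only finitely many strict inequalities between iterates are
involved, so pointwise convergence of the iterates suffices. -/
theorem HasCrossings.eventually {α : Type*} {L : Filter α} {Γ : α → ℝ → ℝ} {G : ℝ → ℝ} {n q : ℕ}
    {p : ℤ} (h : HasCrossings G n p q)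
    (hΓ : ∀ j x, Tendsto (fun t => (Γ t)^[j] x) L (𝓝 (G^[j] x))) :
    ∀ᶠ t in L, HasCrossings (Γ t) n p q := by
  obtain ⟨hq, u, v, hc, hs⟩ := h
  have h1 : ∀ᶠ t in L, ∀ i, IsCrossing (Γ t) p q (u i) (v i) := by
    rw [eventually_all]
    intro i
    filter_upwards [(hΓ q (u i)).eventually_const_lt (hc i).left,
      (hΓ q (v i)).eventually_lt_const (hc i).right] with t h3 h4 using ⟨(hc i).lt, h3, h4⟩
  filter_upwards [h1, hs.eventually hΓ] with t h2 h3 using ⟨hq, u, v, h2, h3⟩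

theorem tendsto_familyLift_iterate {k : ℕ} (θ : Ck k × ℝ × ℝ) (j : ℕ) (x : ℝ) :
    Tendsto (fun t : Ck k × ℝ × ℝ => (familyLift t.1 t.2.1 t.2.2)^[j] x) (𝓝 θ)
      (𝓝 ((familyLift θ.1 θ.2.1 θ.2.2)^[j] x)) :=
  ((continuous_familyLift_iterate j).comp (Continuous.prodMk_left x)).tendsto θ

theorem isOpen_hasCrossings (k n : ℕ) (p : ℤ) (q : ℕ) :
    IsOpen {t : Ck k × ℝ × ℝ | HasCrossings (familyLift t.1 t.2.1 t.2.2) n p q} :=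
  isOpen_iff_eventually.2 fun θ hθ =>
    HasCrossings.eventually hθ fun j x => tendsto_familyLift_iterate θ j x

/-! ### Asymptotic stability on the circle from a derivative bound on the line. -/

section Attracting

theorem coe_iterate {g : S → S} {G : ℝ → ℝ} (h : ∀ x : ℝ, ((G x : ℝ) : S) = g (x : S)) (n : ℕ)
    (x : ℝ) : ((G^[n] x : ℝ) : S) = g^[n] (x : S) :=
  (Semiconj.iterate_right (f := fun x : ℝ => (x : S)) (fun x => h x) n) x

theorem coe_eq_coe_iff {x y : ℝ} : (x : S) = (y : S) ↔ ∃ l : ℤ, y = x + 2 * Real.pi * l := by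
  rw [eq_comm, QuotientAddGroup.eq_iff_sub_mem, AddSubgroup.mem_zmultiples_iff]
  refine exists_congr fun l => ?_
  rw [zsmul_eq_mul]
  constructor <;> intro h <;> linarith

theorem coe_add_two_pi_mul (x : ℝ) (l : ℤ) : ((x + 2 * Real.pi * l : ℝ) : S) = (x : S) :=
  (coe_eq_coe_iff.2 ⟨l, rfl⟩).symm

theorem continuous_of_lift {g : S → S} {G : ℝ → ℝ} (hG : Continuous G)
    (h : ∀ x : ℝ, ((G x : ℝ) : S) = g (x : S)) : Continuous g := by
  refine (QuotientAddGroup.isQuotientMap_mk (AddSubgroup.zmultiples (2 * Real.pi))).continuous_iff.2 ?_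
  exact ((AddCircle.continuous_mk' (2 * Real.pi)).comp hG).congr h

/-- Stability under `g^q` at one point of the orbit spreads to all of it: continuity handles the
fewer than `q` intermediate steps, and every orbit point is carried to `x` by some iterate. -/
theorem isAttracting_of_iterate {g : S → S} (hg : Continuous g) {q : ℕ} (hq : 0 < q) {x : S}
    (hx : g^[q] x = x)
    (hst : ∀ U ∈ 𝓝 x, ∀ᶠ y in 𝓝 x, ∀ n, (g^[q])^[n] y ∈ U)
    (hat : ∀ᶠ y in 𝓝 x, Tendsto (fun n => (g^[q])^[n] y) atTop (𝓝 x)) :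
    IsAttracting g (Set.range fun n : ℕ => g^[n] x) := by
  set O := Set.range fun n : ℕ => g^[n] x with hO
  have hU : ∀ U ∈ 𝓝ˢ O, ∀ w ∈ O, ∀ t : ℕ, ∀ᶠ y in 𝓝 w, ∀ j ∈ Set.Iio t, g^[j] y ∈ U := by
    rintro U hU w ⟨i, rfl⟩ t
    rw [eventually_all_finite (Set.finite_Iio t)]
    intro j _
    refine (hg.iterate j).continuousAt.eventually_mem ?_
    refine mem_nhdsSet_iff_forall.1 hU _ ⟨j + i, ?_⟩
    exact iterate_add_apply g j i x
  have key : ∀ U ∈ 𝓝ˢ O, ∀ᶠ y in 𝓝 x, ∀ m, g^[m] y ∈ U := by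
    intro U hU'
    filter_upwards [hst _ (hU U hU' x ⟨0, rfl⟩ q)] with y hy m
    have h1 := hy (m / q) (m % q) (Nat.mod_lt m hq)
    rwa [← iterate_mul, ← iterate_add_apply, Nat.mod_add_div] at h1
  have back : ∀ w ∈ O, ∃ t : ℕ, Tendsto (g^[t]) (𝓝 w) (𝓝 x) := by
    rintro w ⟨i, rfl⟩
    -- From `g^i x` this many more steps complete `q * i` steps in total, hence return to `x`.
    refine ⟨q * i - i, ?_⟩
    have h1 := (hg.iterate (q * i - i)).tendsto (g^[i] x)
    rwa [← iterate_add_apply, Nat.sub_add_cancel (Nat.le_mul_of_pos_left i hq), iterate_mul,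
      iterate_fixed hx] at h1
  constructor
  · intro U hU'
    rw [eventually_nhdsSet_iff_forall]
    intro w hw
    obtain ⟨t, ht⟩ := back w hw
    filter_upwards [hU U hU' w hw t, ht.eventually (key U hU')] with y h1 h2 n
    rcases lt_or_ge n t with h | h
    · exact h1 n h
    · have h3 := h2 (n - t)
      rwa [← iterate_add_apply, Nat.sub_add_cancel h] at h3
  · rw [eventually_nhdsSet_iff_forall]
    intro w hw
    obtain ⟨t, ht⟩ := back w hw
    filter_upwards [ht.eventually hat] with y hy U hU'
    obtain ⟨n, hn⟩ := (hy.eventually (key U hU')).exists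
    refine mem_map.2 (mem_atTop_sets.2 ⟨q * n + t, fun m hm => ?_⟩)
    have h3 := hn (m - (q * n + t))
    rwa [← iterate_mul, ← iterate_add_apply, ← iterate_add_apply, add_assoc,
      Nat.sub_add_cancel hm] at h3

theorem stable_of_hasDerivAt {H : ℝ → ℝ} {z d : ℝ} (hz : H z = z) (hH : HasDerivAt H d z)
    (hd : |d| < 1) :
    (∀ U ∈ 𝓝 z, ∀ᶠ y in 𝓝 z, ∀ n, H^[n] y ∈ U) ∧
      ∀ᶠ y in 𝓝 z, Tendsto (fun n => H^[n] y) atTop (𝓝 z) := by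
  set κ := (1 + |d|) / 2 with hκ
  have hκ0 : 0 ≤ κ := by positivity
  have hκ1 : κ < 1 := by linarith
  have h1 : ∀ᶠ y in 𝓝 z, |H y - z| ≤ κ * |y - z| := by
    filter_upwards [hH.isLittleO.bound (c := (1 - |d|) / 2) (by linarith)] with y hy
    rw [hz, smul_eq_mul, Real.norm_eq_abs, Real.norm_eq_abs] at hy
    have h2 : |H y - z| ≤ |H y - z - (y - z) * d| + |(y - z) * d| := by
      simpa using abs_add_le (H y - z - (y - z) * d) ((y - z) * d)
    rw [abs_mul] at h2
    rw [hκ]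
    linarith
  obtain ⟨δ, hδ, hball⟩ := Metric.eventually_nhds_iff.1 h1
  have h2 : ∀ y, dist y z < δ → ∀ n, |H^[n] y - z| ≤ κ ^ n * |y - z| := by
    intro y hy n
    induction n with
    | zero => simp
    | succ n ih =>
      rw [iterate_succ_apply']
      have h3 : dist (H^[n] y) z < δ :=
        lt_of_le_of_lt (ih.trans (mul_le_of_le_one_left (abs_nonneg _)
          (pow_le_one₀ hκ0 hκ1.le))) hy
      calc |H (H^[n] y) - z| ≤ κ * |H^[n] y - z| := hball h3
        _ ≤ κ * (κ ^ n * |y - z|) := by gcongr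
        _ = κ ^ (n + 1) * |y - z| := by ring
  constructor
  · intro U hU
    obtain ⟨ε, hε, hεU⟩ := Metric.mem_nhds_iff.1 hU
    filter_upwards [Metric.ball_mem_nhds z hδ, Metric.ball_mem_nhds z hε] with y hy hy' n
    refine hεU (lt_of_le_of_lt ((h2 y hy n).trans (mul_le_of_le_one_left (abs_nonneg _)
          (pow_le_one₀ hκ0 hκ1.le))) hy')
  · filter_upwards [Metric.ball_mem_nhds z hδ] with y hy
    rw [tendsto_iff_dist_tendsto_zero]
    refine squeeze_zero (fun _ => dist_nonneg) (fun n => h2 y hy n) ?_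
    simpa using (tendsto_pow_atTop_nhds_zero_of_lt_one hκ0 hκ1).mul_const |y - z|

theorem map_coe_nhds (z : ℝ) : map (fun y : ℝ => (y : S)) (𝓝 z) = 𝓝 (z : S) :=
  (QuotientAddGroup.isOpenQuotientMap_mk (N := AddSubgroup.zmultiples (2 * Real.pi))).map_nhds_eq z

theorem isAttracting_of_hasDerivAt {g : S → S} {G : ℝ → ℝ} (hG : Continuous G)
    (h : ∀ x : ℝ, ((G x : ℝ) : S) = g (x : S)) {q : ℕ} (hq : 0 < q) {p : ℤ} {z d : ℝ}
    (hz : G^[q] z = z + 2 * Real.pi * p) (hd : HasDerivAt G^[q] d z) (hd1 : |d| < 1) :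
    IsAttracting g (Set.range fun n : ℕ => g^[n] (z : S)) := by
  set H : ℝ → ℝ := fun y => G^[q] y - 2 * Real.pi * p with hH
  have hs : ∀ y : ℝ, ((H y : ℝ) : S) = g^[q] (y : S) := by
    intro y
    rw [← coe_iterate h, ← coe_add_two_pi_mul (H y) p, hH]
    simp only [sub_add_cancel]
  obtain ⟨h1, h2⟩ := stable_of_hasDerivAt (H := H) (by rw [hH]; simp only; linarith)
    (hd.sub_const _) hd1
  refine isAttracting_of_iterate (continuous_of_lift hG h) hq ?_ ?_ ?_
  · rw [← coe_iterate h, hz, coe_add_two_pi_mul]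
  · intro U hU
    rw [← map_coe_nhds] at hU ⊢
    rw [eventually_map]
    filter_upwards [h1 _ hU] with y hy n
    rw [← coe_iterate hs]
    exact hy n
  · rw [← map_coe_nhds, eventually_map]
    filter_upwards [h2] with y hy
    simp only [← coe_iterate hs]
    exact tendsto_map.comp hy

end Attracting

/-! ### From crossings to attracting orbits. -/

/-- At the first zero `z` of the displacement in `[u, v]`, the displacement is positive just to the
left. Its derivative there is therefore at most `0`, while monotonicity makes that of `G^q`
nonnegative. -/
theorem IsCrossing.exists_fixed {G : ℝ → ℝ} {p : ℤ} {q : ℕ} {u v : ℝ} (h : IsCrossing G p q u v)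
    (hG : Differentiable ℝ G) (hm : StrictMono G) :
    ∃ z ∈ Set.Icc u v, ∃ d, G^[q] z = z + 2 * Real.pi * p ∧ HasDerivAt G^[q] d z ∧
      0 ≤ d ∧ d ≤ 1 := by
  have hGq : Differentiable ℝ G^[q] := hG.iterate q
  set D : ℝ → ℝ := fun y => G^[q] y - (y + 2 * Real.pi * p) with hD
  have hDc : Continuous D := hGq.continuous.sub (by fun_prop)
  have hne : (Set.Icc u v ∩ D ⁻¹' Set.Iic 0).Nonempty :=
    ⟨v, ⟨h.lt.le, le_rfl⟩, sub_nonpos.2 h.right.le⟩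
  obtain ⟨z, ⟨hz, hz0⟩, hmin⟩ :=
    (isCompact_Icc.inter_right (isClosed_Iic.preimage hDc)).exists_isLeast hne
  have hpos : ∀ y ∈ Set.Ico u z, 0 < D y := by
    intro y hy
    by_contra hy'
    exact absurd (hmin ⟨⟨hy.1, hy.2.le.trans hz.2⟩, not_lt.1 hy'⟩) (not_le.2 hy.2)
  have huz : u < z := by
    refine lt_of_le_of_ne hz.1 fun hu => ?_
    have h1 : D u ≤ 0 := hu ▸ hz0
    linarith [h.left, show D u = G^[q] u - (u + 2 * Real.pi * p) from rfl]
  have hev : ∀ᶠ y in 𝓝[<] z, y ∈ Set.Ico u z := Ico_mem_nhdsLT huz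
  have hDz : D z = 0 := by
    refine le_antisymm hz0 ?_
    refine ge_of_tendsto (hDc.continuousAt.tendsto.mono_left nhdsWithin_le_nhds : Tendsto D (𝓝[<] z) _) ?_
    filter_upwards [hev] with y hy using (hpos y hy).le
  have hd := (hGq z).hasDerivAt
  refine ⟨z, hz, _, by linarith [show D z = G^[q] z - (z + 2 * Real.pi * p) from rfl], hd, ?_, ?_⟩
  · exact (hm.monotone.iterate q).deriv_nonneg
  · have h1 : HasDerivAt D (deriv G^[q] z - 1) z :=
      hd.sub ((hasDerivAt_id z).add_const (2 * Real.pi * (p : ℝ)))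
    have h2 := (hasDerivAt_iff_tendsto_slope.1 h1).mono_left
      (nhdsWithin_mono z (s := Set.Iio z) fun y hy => ne_of_lt hy)
    have h3 := le_of_tendsto h2 (b := 0) (by
      filter_upwards [hev] with y hy
      rw [slope_def_field, hDz, sub_zero]
      exact div_nonpos_of_nonneg_of_nonpos (hpos y hy).le (by linarith [hy.2]))
    linarith

/-- Nondegeneracy improves the derivative bound to `d < 1`, so each crossing contains an attracting
point. Separation prevents two of these points from sharing an orbit. -/
theorem HasCrossings.le_numAttracting {g : S → S} {G : ℝ → ℝ}
    (h : ∀ x : ℝ, ((G x : ℝ) : S) = g (x : S)) {n : ℕ} {p : ℤ} {q : ℕ}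
    (hc : HasCrossings G n p q) (hG : Differentiable ℝ G) (hm : StrictMono G)
    (hnd : ∀ x, G^[q] x = x + 2 * Real.pi * p → deriv G^[q] x ≠ 1) :
    (n : ℕ∞) ≤ numAttracting g := by
  obtain ⟨hq, u, v, hcr, hs⟩ := hc
  choose z hz d hfix hd hd0 hd1 using fun i => (hcr i).exists_fixed hG hm
  set O : Fin n → Set S := fun i => Set.range fun m : ℕ => g^[m] (z i : S) with hO
  have hper : ∀ i, IsPeriodicPt g q (z i : S) := fun i => by
    change g^[q] (z i : S) = z i
    rw [← coe_iterate h, hfix, coe_add_two_pi_mul]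
  have hinj : Injective O := by
    intro i i' hii
    by_contra hne
    have h1 : (z i' : S) ∈ O i := hii ▸ ⟨0, rfl⟩
    obtain ⟨m, hm'⟩ := h1
    have hm' : g^[m] (z i : S) = z i' := hm'
    rw [← (hper i).iterate_mod_apply, ← coe_iterate h, coe_eq_coe_iff] at hm'
    obtain ⟨l', hl'⟩ := hm'
    obtain ⟨l, h2, h3⟩ := hs i i' hne (m % q) (Nat.mod_lt m hq)
    have hmon := (hm.iterate (m % q)).monotone
    have h4 := hmon (hz i).1
    have h5 := hmon (hz i).2
    have hpi := Real.two_pi_pos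
    have h6 : 2 * Real.pi * ((l : ℝ) - 1) < 2 * Real.pi * (-l' : ℝ) := by
      linarith [(hz i').2]
    have h7 : 2 * Real.pi * (-l' : ℝ) < 2 * Real.pi * l := by
      linarith [(hz i').1]
    have h8 := lt_of_mul_lt_mul_left h6 hpi.le
    have h9 := lt_of_mul_lt_mul_left h7 hpi.le
    have h10 : l - 1 < -l' := by exact_mod_cast h8
    have h11 : -l' < l := by exact_mod_cast h9
    omega
  have hsub : Set.range O ⊆ {O : Set S | IsPeriodicTrajectory g O ∧ IsAttracting g O} := by
    rintro _ ⟨i, rfl⟩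
    refine ⟨⟨z i, mk_mem_periodicPts hq (hper i), rfl⟩, ?_⟩
    refine isAttracting_of_hasDerivAt hG.continuous h hq (hfix i) (hd i) ?_
    rw [abs_of_nonneg (hd0 i)]
    exact lt_of_le_of_ne (hd1 i) fun h1 => hnd _ (hfix i) (by rw [(hd i).deriv, h1])
  have h1 := hinj.encard_range.trans (Set.encard_le_encard hsub)
  rwa [ENat.card_eq_coe_fintype_card, Fintype.card_fin] at h1

theorem tendsto_rotation {G : ℝ → ℝ} (hm : Monotone G)
    (h1 : ∀ x, G (x + 2 * Real.pi) = G x + 2 * Real.pi) {p : ℤ} {q : ℕ} (hq : 0 < q) {z : ℝ}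
    (hz : G^[q] z = z + 2 * Real.pi * p) (x : ℝ) :
    Tendsto (fun n : ℕ => (G^[n] x - x) / (2 * Real.pi * n)) atTop (𝓝 (p / q)) := by
  have hpi := Real.two_pi_pos
  let F : CircleDeg1Lift :=
    { toFun := fun t => G (2 * Real.pi * t) / (2 * Real.pi)
      monotone' := fun s t hst => by
        have := hm (mul_le_mul_of_nonneg_left hst hpi.le)
        exact div_le_div_of_nonneg_right this hpi.le
      map_add_one' := fun t => by
        rw [mul_add, mul_one, h1, add_div, div_self hpi.ne'] }
  have hF : ∀ n : ℕ, ∀ y : ℝ, (F ^ n) (y / (2 * Real.pi)) = G^[n] y / (2 * Real.pi) := by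
    intro n
    induction n with
    | zero => intro y; simp
    | succ n ih =>
      intro y
      rw [iterate_succ_apply, ← ih, pow_succ, CircleDeg1Lift.mul_apply]
      congr 1
      change G (2 * Real.pi * (y / (2 * Real.pi))) / (2 * Real.pi) = _
      rw [mul_div_cancel₀ _ hpi.ne']
  have hτ : F.translationNumber = p / q := by
    refine F.translationNumber_of_map_pow_eq_add_int (x := z / (2 * Real.pi)) ?_ hq
    rw [hF, hz]
    field_simp
  have h2 := F.tendsto_translationNumber (x / (2 * Real.pi))
  rw [hτ] at h2
  refine h2.congr fun n => ?_
  rw [hF, ← sub_div, div_div]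

/-- A one-dimensional Sard argument. Growth in the parameter means that a point `x` is `q`-periodic
for at most one `r = R x`. At a tangency the displacement is `o(|y - x|)`, so `R` has derivative
zero along the set of degenerate points and its image is null. -/
theorem volume_degenerate_eq_zero {k : ℕ} (hk : 1 ≤ k) (f : Ck k) {a : ℝ} (ha : |a| * ‖f‖ < 1)
    (p : ℤ) {q : ℕ} (hq : 0 < q) :
    volume {r : ℝ | ∃ x, (familyLift f r a)^[q] x = x + 2 * Real.pi * p ∧
      deriv (familyLift f r a)^[q] x = 1} = 0 := by
  have hpi := Real.two_pi_pos
  set P : ℝ → ℝ → Prop := fun r x => (familyLift f r a)^[q] x = x + 2 * Real.pi * p ∧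
      deriv (familyLift f r a)^[q] x = 1 with hP
  have hle : ∀ r s x, 2 * Real.pi * |s - r| ≤
      |(familyLift f s a)^[q] x - (familyLift f r a)^[q] x| := by
    intro r s x
    rcases le_total r s with h | h
    · have := familyLift_iterate_add_le hk f ha h x hq
      rw [abs_of_nonneg (sub_nonneg.2 h)]
      exact le_trans (by linarith) (le_abs_self _)
    · have := familyLift_iterate_add_le hk f ha h x hq
      rw [abs_of_nonpos (sub_nonpos.2 h)]
      exact le_trans (by linarith) (neg_le_abs _)
  set C : Set ℝ := {x | ∃ r, P r x} with hC
  choose! R hR using fun x (hx : x ∈ C) => hx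
  have hsub : {r : ℝ | ∃ x, P r x} ⊆ R '' C := by
    rintro r ⟨x, hx⟩
    have hxC : x ∈ C := ⟨r, hx⟩
    refine ⟨x, hxC, ?_⟩
    have h1 := hle r (R x) x
    rw [(hR x hxC).1, hx.1, sub_self, abs_zero] at h1
    have h2 : |R x - r| ≤ 0 := by nlinarith
    linarith [abs_nonpos_iff.1 h2]
  refine measure_mono_null hsub ?_
  refine addHaar_image_eq_zero_of_det_fderivWithin_eq_zero volume
    (f' := fun _ => (0 : ℝ →L[ℝ] ℝ)) (fun x hx => ?_) (fun x _ => ?_)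
  · rw [hasFDerivWithinAt_iff_isLittleO]
    have hG := ((differentiable_familyLift hk f (R x) a).iterate q x).hasDerivAt
    rw [(hR x hx).2] at hG
    have h1 := hG.isLittleO.mono (nhdsWithin_le_nhds (s := C))
    refine Asymptotics.IsBigO.trans_isLittleO ?_ h1
    refine Asymptotics.IsBigO.of_bound 1 ?_
    filter_upwards [self_mem_nhdsWithin] with y hy
    have h2 := hle (R x) (R y) y
    rw [(hR y hy).1] at h2
    rw [(hR x hx).1]
    simp only [_root_.zero_apply, sub_zero, Real.norm_eq_abs, one_mul, smul_eq_mul,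
      mul_one]
    have h3 : (familyLift f (R x) a)^[q] y - (x + 2 * Real.pi * p) - (y - x) =
      -(y + 2 * Real.pi * p - (familyLift f (R x) a)^[q] y) := by ring
    rw [h3, abs_neg]
    have h4 : 1 ≤ 2 * Real.pi := by linarith [Real.pi_gt_three]
    exact le_trans (le_mul_of_one_le_left (abs_nonneg _) h4) h2
  · simp [ContinuousLinearMap.det]

/-- The crossings persist for `s` in a neighbourhood of `r`, which has positive measure and so
contains a nondegenerate parameter. The periodic point inside a crossing pins the rotation number at
`p / q`, whatever `s` is. -/
theorem HasCrossings.exists_numAttracting {k : ℕ} (hk : 1 ≤ k) {f : Ck k} {r a : ℝ}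
    (ha : |a| * ‖f‖ < 1) {n : ℕ} (hn : 0 < n) {p : ℤ} {q : ℕ}
    (hc : HasCrossings (familyLift f r a) n p q) :
    ∃ s, HasRotationNumber (family f s a) (p / q) ∧ (n : ℕ∞) ≤ numAttracting (family f s a) := by
  have hev : ∀ᶠ s in 𝓝 r, HasCrossings (familyLift f s a) n p q :=
    hc.eventually fun j x => by
      have h1 := tendsto_familyLift_iterate (f, r, a) j x
      have h2 : Tendsto (fun s : ℝ => (f, s, a)) (𝓝 r) (𝓝 (f, r, a)) :=
        Continuous.tendsto (by fun_prop) r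
      exact h1.comp h2
  obtain ⟨hq, -⟩ := id hc
  obtain ⟨s, hs, hs'⟩ : ∃ s, HasCrossings (familyLift f s a) n p q ∧
      ∀ x, (familyLift f s a)^[q] x = x + 2 * Real.pi * p →
        deriv (familyLift f s a)^[q] x ≠ 1 := by
    by_contra hcon
    push Not at hcon
    have h1 : {s | HasCrossings (familyLift f s a) n p q} ⊆
        {r : ℝ | ∃ x, (familyLift f r a)^[q] x = x + 2 * Real.pi * p ∧
          deriv (familyLift f r a)^[q] x = 1} := fun s hs => by
      obtain ⟨x, hx⟩ := hcon s hs
      exact ⟨x, hx⟩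
    have h2 := measure_mono_null h1 (volume_degenerate_eq_zero hk f ha p hq)
    exact (Measure.measure_pos_of_mem_nhds volume hev).ne' h2
  have hG := differentiable_familyLift hk f s a
  have hm := strictMono_familyLift hk f ha s
  refine ⟨s, ?_, hs.le_numAttracting (coe_familyLift f s a) hG hm hs'⟩
  obtain ⟨-, u, v, hcr, -⟩ := hs
  obtain ⟨z, -, d, hz, -⟩ := (hcr ⟨0, hn⟩).exists_fixed hG hm
  exact ⟨familyLift f s a, hG.continuous, familyLift_add f s a, coe_familyLift f s a,
    tendsto_rotation hm.monotone (familyLift_add f s a) hq hz⟩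

/-! ### From attracting orbits to crossings. -/

section Converse

/-- Without fixed points the displacement has constant sign on the left of `z`. If it were negative,
orbits would decrease there. An orbit starting near `z` cannot pass a fixed `w < z`, because it
would have to land in the forbidden interval `[H w, w]`. It would then converge to a fixed point in
`[w, z)`, which does not exist. -/
theorem lt_map_of_stable_left {H : ℝ → ℝ} (hm : StrictMono H) (hH : Continuous H) {z δ : ℝ}
    (hδ : 0 < δ) (hz : H z = z) (hne : ∀ y ∈ Set.Ioo (z - δ) z, H y ≠ y)
    (hst : ∀ a b, Set.Icc a b ⊆ Set.Ioo (z - δ) z → ∀ᶠ y in 𝓝 z, ∀ n, H^[n] y ∉ Set.Icc a b) :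
    ∀ y ∈ Set.Ioo (z - δ) z, y < H y := by
  intro y₀ hy₀
  by_contra hcon
  have hlt0 : H y₀ < y₀ := lt_of_le_of_ne (not_lt.1 hcon) (hne y₀ hy₀)
  have hlt : ∀ y ∈ Set.Ioo (z - δ) z, H y < y := by
    intro y hy
    by_contra hcon'
    obtain ⟨c, hc, hc'⟩ := isPreconnected_Ioo.intermediate_value₂ hy₀ hy hH.continuousOn
      continuousOn_id hlt0.le (not_lt.1 hcon')
    exact hne c hc hc'
  have hnear : ∀ᶠ w in 𝓝[<] z, w ∈ Set.Ioo (z - δ) z ∧ z - δ < H w := by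
    have h1 : Tendsto H (𝓝[<] z) (𝓝 z) := by
      have := hH.tendsto z
      rw [hz] at this
      exact this.mono_left nhdsWithin_le_nhds
    have h2 : ∀ᶠ w in 𝓝[<] z, w ∈ Set.Ioo (z - δ) z := Ioo_mem_nhdsLT (by linarith)
    exact h2.and (h1.eventually_const_lt (by linarith))
  obtain ⟨w, hw, hw'⟩ := hnear.exists
  have hev : ∀ᶠ y in 𝓝[<] z, y ∈ Set.Ioo w z ∧ ∀ n, H^[n] y ∉ Set.Icc (H w) w :=
    Filter.Eventually.and (Ioo_mem_nhdsLT hw.2)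
      (nhdsWithin_le_nhds (hst (H w) w fun t ht => ⟨hw'.trans_le ht.1, ht.2.trans_lt hw.2⟩))
  obtain ⟨y, hy, hyn⟩ := hev.exists
  have hmem : ∀ n, H^[n] y ∈ Set.Ioo w z := by
    intro n
    induction n with
    | zero => exact hy
    | succ n ih =>
      have h1 := hyn (n + 1)
      rw [iterate_succ_apply'] at h1 ⊢
      have h2 := hm ih.1
      have h3 := hm ih.2
      rw [hz] at h3
      refine ⟨?_, h3⟩
      by_contra h4
      exact h1 ⟨h2.le, not_lt.1 h4⟩
  have hanti : Antitone fun n => H^[n] y := antitone_nat_of_succ_le fun n => by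
    rw [iterate_succ_apply']
    exact (hlt _ ⟨hw.1.trans (hmem n).1, (hmem n).2⟩).le
  have hlim := tendsto_atTop_ciInf hanti ⟨w, by rintro _ ⟨n, rfl⟩; exact (hmem n).1.le⟩
  set L := ⨅ n, H^[n] y
  have hL1 : w ≤ L := ge_of_tendsto' hlim fun n => (hmem n).1.le
  have hL2 : L < z := (hanti.le_of_tendsto hlim 0).trans_lt hy.2
  have hfix : H L = L := by
    refine tendsto_nhds_unique ((hH.tendsto L).comp hlim) ?_
    refine (hlim.comp (tendsto_add_atTop_nat 1)).congr fun n => ?_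
    exact iterate_succ_apply' H n y
  exact hne L ⟨hw.1.trans_le hL1, hL2⟩ hfix

theorem map_lt_of_stable_right {H : ℝ → ℝ} (hm : StrictMono H) (hH : Continuous H) {z δ : ℝ}
    (hδ : 0 < δ) (hz : H z = z) (hne : ∀ y ∈ Set.Ioo z (z + δ), H y ≠ y)
    (hst : ∀ a b, Set.Icc a b ⊆ Set.Ioo z (z + δ) → ∀ᶠ y in 𝓝 z, ∀ n, H^[n] y ∉ Set.Icc a b) :
    ∀ y ∈ Set.Ioo z (z + δ), H y < y := by
  have hit : ∀ n y, (fun t => -H (-t))^[n] y = -H^[n] (-y) := by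
    intro n y
    induction n with
    | zero => simp
    | succ n ih => rw [iterate_succ_apply', iterate_succ_apply', ih, neg_neg]
  -- The reflection `t ↦ -t` exchanges the two sides.
  have key := lt_map_of_stable_left (H := fun t => -H (-t)) (z := -z) (δ := δ)
    (fun s t hst => neg_lt_neg (hm (neg_lt_neg hst))) (by fun_prop) hδ (by simp [hz])
    (fun y hy h => hne (-y) ⟨by linarith [hy.2], by linarith [hy.1]⟩ (by linarith))
    (fun a b hab => by
      have h1 := hst (-b) (-a) fun t ht => by
        have h2 := hab (show -t ∈ Set.Icc a b from ⟨by linarith [ht.2], by linarith [ht.1]⟩)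
        exact ⟨by linarith [h2.2], by linarith [h2.1]⟩
      filter_upwards [(continuous_neg.tendsto' (-z) z (neg_neg z)).eventually h1] with y hy n h3
      rw [hit] at h3
      exact hy n ⟨by linarith [h3.2], by linarith [h3.1]⟩)
  intro y hy
  have h1 := key (-y) ⟨by linarith [hy.2], by linarith [hy.1]⟩
  simp only [neg_neg] at h1
  linarith

/-- Attraction excludes other fixed points of `g^q` near `z`. Stability, applied to the complement
of the image of a compact interval off the orbit, says that orbits starting near `z` avoid that
interval. -/
theorem eventually_displacement {g : S → S} {G : ℝ → ℝ} (hG : Continuous G) (hm : StrictMono G)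
    (h : ∀ x : ℝ, ((G x : ℝ) : S) = g (x : S)) {q : ℕ} (hq : 0 < q) {p : ℤ} {z : ℝ}
    (hz : G^[q] z = z + 2 * Real.pi * p)
    (hatt : IsAttracting g (Set.range fun n : ℕ => g^[n] (z : S))) :
    (∀ᶠ u in 𝓝[<] z, u + 2 * Real.pi * p < G^[q] u) ∧
      ∀ᶠ v in 𝓝[>] z, G^[q] v < v + 2 * Real.pi * p := by
  set O := Set.range fun n : ℕ => g^[n] (z : S) with hO
  set H : ℝ → ℝ := fun y => G^[q] y - 2 * Real.pi * p with hH
  have hs : ∀ y : ℝ, ((H y : ℝ) : S) = g^[q] (y : S) := by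
    intro y
    rw [← coe_iterate h, ← coe_add_two_pi_mul (H y) p, hH]
    simp only [sub_add_cancel]
  have hHc : Continuous H := (hG.iterate q).sub continuous_const
  have hHm : StrictMono H := fun s t hst => sub_lt_sub_right (hm.iterate q hst) _
  have hHz : H z = z := by
    rw [hH]
    simp only
    linarith
  have hper : IsPeriodicPt g q (z : S) := by
    change g^[q] (z : S) = z
    rw [← hs, hHz]
  have hfin : O.Finite := by
    refine ((Set.finite_Iio q).image fun n => g^[n] (z : S)).subset ?_
    rintro _ ⟨n, rfl⟩
    exact ⟨n % q, Nat.mod_lt n hq, hper.iterate_mod_apply n⟩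
  have hzO : (z : S) ∈ O := ⟨0, rfl⟩
  have hcoe : Tendsto (fun y : ℝ => (y : S)) (𝓝 z) (𝓝 (z : S)) := (map_coe_nhds z).le
  have hev : ∀ᶠ y : ℝ in 𝓝 z, y ≠ z → (y : S) ∉ O ∧ H y ≠ y := by
    have h1 : ∀ᶠ y : ℝ in 𝓝 z, (y : S) ∈ (O \ {(z : S)})ᶜ :=
      hcoe.eventually ((hfin.sdiff).isClosed.isOpen_compl.mem_nhds fun hmem => hmem.2 rfl)
    have h2 : ∀ᶠ y : ℝ in 𝓝 z, |y - z| < 2 * Real.pi := eventually_abs_sub_lt z Real.two_pi_pos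
    have h3 := hcoe.eventually (eventually_nhdsSet_iff_forall.1 hatt.2 _ hzO)
    filter_upwards [h1, h2, h3] with y hy1 hy2 hy3 hyz
    have hyO : (y : S) ∉ O := by
      intro hyO
      have h4 : (z : S) = (y : S) := by
        by_contra hne
        exact hy1 ⟨hyO, fun h => hne h.symm⟩
      obtain ⟨l, hl⟩ := coe_eq_coe_iff.1 h4
      have hl0 : l ≠ 0 := by
        rintro rfl
        exact hyz (by simpa using hl)
      have h5 : (1 : ℝ) ≤ |(l : ℝ)| := by exact_mod_cast Int.one_le_abs hl0
      rw [hl, add_sub_cancel_left, abs_mul, abs_of_pos Real.two_pi_pos] at hy2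
      nlinarith [Real.two_pi_pos]
    refine ⟨hyO, fun hfix => ?_⟩
    have h4 : ({(y : S)}ᶜ : Set S) ∈ 𝓝ˢ O :=
      isOpen_compl_singleton.mem_nhdsSet.2 fun w hw hwy => hyO (hwy ▸ hw)
    obtain ⟨N, hN⟩ := eventually_atTop.1 (hy3.eventually h4)
    refine hN (q * N) (Nat.le_mul_of_pos_left N hq) ?_
    rw [Set.mem_singleton_iff, iterate_mul]
    refine iterate_fixed ?_ N
    rw [← hs, hfix]
  obtain ⟨δ, hδ, hball⟩ := Metric.eventually_nhds_iff.1 hev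
  have hst : ∀ a b, (∀ y ∈ Set.Icc a b, dist y z < δ ∧ y ≠ z) →
      ∀ᶠ y in 𝓝 z, ∀ n, H^[n] y ∉ Set.Icc a b := by
    intro a b hab
    have hU : (((fun y : ℝ => (y : S)) '' Set.Icc a b)ᶜ : Set S) ∈ 𝓝ˢ O := by
      refine (isCompact_Icc.image (AddCircle.continuous_mk' _)).isClosed.isOpen_compl.mem_nhdsSet.2
        ?_
      rintro w hw ⟨y, hy, rfl⟩
      exact (hball (hab y hy).1 (hab y hy).2).1 hw
    filter_upwards [hcoe.eventually (eventually_nhdsSet_iff_forall.1 (hatt.1 _ hU) _ hzO)]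
      with y hy n hmem
    refine hy (q * n) ⟨_, hmem, ?_⟩
    simp only
    rw [coe_iterate hs, iterate_mul]
  have hleft := lt_map_of_stable_left hHm hHc hδ hHz
    (fun y hy => (hball (by rw [Real.dist_eq, abs_lt]; constructor <;> linarith [hy.1, hy.2])
      hy.2.ne).2)
    (fun a b hab => hst a b fun y hy =>
      ⟨by rw [Real.dist_eq, abs_lt]; constructor <;> linarith [(hab hy).1, (hab hy).2],
        (hab hy).2.ne⟩)
  have hright := map_lt_of_stable_right hHm hHc hδ hHz
    (fun y hy => (hball (by rw [Real.dist_eq, abs_lt]; constructor <;> linarith [hy.1, hy.2])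
      hy.1.ne').2)
    (fun a b hab => hst a b fun y hy =>
      ⟨by rw [Real.dist_eq, abs_lt]; constructor <;> linarith [(hab hy).1, (hab hy).2],
        (hab hy).1.ne'⟩)
  constructor
  · filter_upwards [Ioo_mem_nhdsLT (show z - δ < z by linarith)] with u hu
    have := hleft u hu
    simp only [hH] at this
    linarith
  · filter_upwards [Ioo_mem_nhdsGT (show z < z + δ by linarith)] with v hv
    have := hright v hv
    simp only [hH] at this
    linarith

/-- The lift in `HasRotationNumber` is arbitrary. Two lifts differ by a constant integer multiple of
`2π`, which is absorbed in `r`. -/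
theorem exists_familyLift_eq {k : ℕ} (f : Ck k) (r a : ℝ) {G : ℝ → ℝ} (hG : Continuous G)
    (h : ∀ x : ℝ, ((G x : ℝ) : S) = family f r a (x : S)) :
    ∃ s, G = familyLift f s a ∧ family f s a = family f r a := by
  have h1 : ∀ x, ∃ l : ℤ, G x = familyLift f r a x + 2 * Real.pi * l := fun x =>
    coe_eq_coe_iff.1 (by rw [h, coe_familyLift])
  choose l hl using h1
  have hlc : Continuous l := by
    rw [Int.isClosedEmbedding_coe_real.isEmbedding.continuous_iff]
    have h2 : ((↑) : ℤ → ℝ) ∘ l = fun x => (G x - familyLift f r a x) / (2 * Real.pi) := by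
      funext x
      simp only [comp_apply]
      rw [hl x]
      field_simp
      ring
    rw [h2]
    exact (hG.sub (continuous_familyLift f r a)).div_const _
  have hconst : ∀ x, l x = l 0 := fun x => PreconnectedSpace.constant inferInstance hlc
  have h3 : ∀ x, familyLift f (r + l 0) a x = familyLift f r a x + 2 * Real.pi * l 0 := by
    intro x
    unfold familyLift
    ring
  refine ⟨r + l 0, ?_, ?_⟩
  · funext x
    rw [hl x, hconst x, h3]
  · funext x
    induction x using QuotientAddGroup.induction_on with
    | H x =>
      rw [← coe_familyLift, ← coe_familyLift, h3, coe_add_two_pi_mul]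

theorem exists_int_between {x y : ℝ} (h : (x : S) ≠ (y : S)) :
    ∃ l : ℤ, y + 2 * Real.pi * (l - 1) < x ∧ x < y + 2 * Real.pi * l := by
  have hpi := Real.two_pi_pos
  refine ⟨⌈(x - y) / (2 * Real.pi)⌉, ?_, ?_⟩
  · have h1 := Int.ceil_lt_add_one ((x - y) / (2 * Real.pi))
    have h2 : (⌈(x - y) / (2 * Real.pi)⌉ - 1 : ℝ) < (x - y) / (2 * Real.pi) := by linarith
    rw [lt_div_iff₀ hpi] at h2
    linarith
  · have h1 := Int.le_ceil ((x - y) / (2 * Real.pi))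
    rw [div_le_iff₀ hpi] at h1
    refine lt_of_le_of_ne (by linarith) fun heq => h ?_
    exact (coe_eq_coe_iff.2 ⟨_, heq⟩).symm

theorem exists_hasCrossings {k : ℕ} (hk : 1 ≤ k) {f : Ck k} {r a ρ : ℝ} (ha : |a| * ‖f‖ < 1)
    {n : ℕ} (hn : 0 < n) (hρ : HasRotationNumber (family f r a) ρ)
    (hN : (n : ℕ∞) ≤ numAttracting (family f r a)) :
    ∃ (s : ℝ) (p : ℤ) (q : ℕ), ρ = p / q ∧ HasCrossings (familyLift f s a) n p q := by
  obtain ⟨G, hGc, -, hGl, hGρ⟩ := hρ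
  obtain ⟨s, rfl, -⟩ := exists_familyLift_eq f r a hGc hGl
  set G := familyLift f s a
  set g := family f r a
  have hm : StrictMono G := strictMono_familyLift hk f ha s
  obtain ⟨t, ht, htn⟩ := Set.exists_subset_encard_eq hN
  have htf : t.Finite := Set.finite_of_encard_eq_coe htn
  have hcard : Nat.card t = n := by
    rw [Nat.card_coe_set_eq, Set.ncard, htn, ENat.toNat_natCast]
  have : Finite t := htf
  let e : Fin n ≃ t := (Finite.equivFinOfCardEq hcard).symm
  choose x hx hxO using fun i => (ht (e i).2).1
  have hatt := fun i => (ht (e i).2).2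
  choose per hper hper' using hx
  have hz : ∀ i, ∃ z : ℝ, (z : S) = x i := fun i => QuotientAddGroup.mk_surjective (x i)
  choose z hz using hz
  -- A common period is enough; it need not be minimal. All orbits then have the same `p`, since
  -- they share the rotation number `ρ = p / q`.
  set q := ∏ i, per i with hq
  have hq0 : 0 < q := Finset.prod_pos fun i _ => hper i
  have hqper : ∀ i, IsPeriodicPt g q (x i) := fun i =>
    (hper' i).trans_dvd (Finset.dvd_prod_of_mem per (Finset.mem_univ i))
  have hp : ∀ i, ∃ p : ℤ, G^[q] (z i) = z i + 2 * Real.pi * p := fun i => by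
    refine coe_eq_coe_iff.1 ?_
    rw [coe_iterate hGl, hz, (hqper i).eq]
  choose p hp using hp
  have hρp : ∀ i, ρ = p i / q := fun i =>
    tendsto_nhds_unique (hGρ (z i))
      (tendsto_rotation hm.monotone (familyLift_add f s a) hq0 (hp i) (z i))
  have hpp : ∀ i, p i = p ⟨0, hn⟩ := fun i => by
    have h1 := (hρp i).symm.trans (hρp ⟨0, hn⟩)
    have hq' : (q : ℝ) ≠ 0 := by exact_mod_cast hq0.ne'
    rw [div_left_inj' hq'] at h1
    exact_mod_cast h1
  set p₀ := p ⟨0, hn⟩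
  have hfix : ∀ i, G^[q] (z i) = z i + 2 * Real.pi * p₀ := fun i => by rw [hp i, hpp i]
  have hdisp := fun i => eventually_displacement hGc hm hGl hq0 (hfix i)
    (by rw [hz i, ← hxO i]; exact hatt i)
  have hsep : ∀ i i', i ≠ i' → ∀ j, ((G^[j] (z i) : ℝ) : S) ≠ (z i' : S) := by
    intro i i' hii j hj
    rw [coe_iterate hGl, hz, hz] at hj
    refine hii (e.injective (Subtype.ext ?_))
    rw [hxO i, hxO i']
    apply Set.Subset.antisymm
    · rintro _ ⟨m, rfl⟩
      refine ⟨m + (q * j - j), ?_⟩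
      simp only
      rw [← hj, ← iterate_add_apply, add_assoc, Nat.sub_add_cancel (Nat.le_mul_of_pos_left j hq0),
        iterate_add_apply, ((hqper i).mul_const j).eq]
    · rintro _ ⟨m, rfl⟩
      refine ⟨m + j, ?_⟩
      simp only
      rw [← hj, iterate_add_apply]
  have hL : ∀ w : ℝ, Tendsto (fun δ : ℝ => w - δ) (𝓝[>] 0) (𝓝[<] w) := fun w => by
    refine tendsto_nhdsWithin_iff.2 ⟨?_, ?_⟩
    · exact (Continuous.tendsto' (by fun_prop) 0 w (sub_zero w)).mono_left nhdsWithin_le_nhds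
    · filter_upwards [self_mem_nhdsWithin] with δ hδ
      exact sub_lt_self w hδ
  have hR : ∀ w : ℝ, Tendsto (fun δ : ℝ => w + δ) (𝓝[>] 0) (𝓝[>] w) := fun w => by
    refine tendsto_nhdsWithin_iff.2 ⟨?_, ?_⟩
    · exact (Continuous.tendsto' (by fun_prop) 0 w (add_zero w)).mono_left nhdsWithin_le_nhds
    · filter_upwards [self_mem_nhdsWithin] with δ hδ
      exact lt_add_of_pos_right w hδ
  have hL' := fun w => tendsto_nhds_of_tendsto_nhdsWithin (hL w)
  have hR' := fun w => tendsto_nhds_of_tendsto_nhdsWithin (hR w)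
  have h1 : ∀ᶠ δ in 𝓝[>] (0 : ℝ), ∀ i, IsCrossing G p₀ q (z i - δ) (z i + δ) := by
    rw [eventually_all]
    intro i
    filter_upwards [(hL (z i)).eventually (hdisp i).1, (hR (z i)).eventually (hdisp i).2,
      self_mem_nhdsWithin] with δ h1 h2 h3
    have h3 : 0 < δ := h3
    exact ⟨by linarith, h1, h2⟩
  have h2 : ∀ᶠ δ in 𝓝[>] (0 : ℝ), Separated G q (fun i => z i - δ) (fun i => z i + δ) := by
    unfold Separated
    simp only [eventually_all]
    intro i i' hii
    rw [eventually_all_finite (Set.finite_Iio q)]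
    intro j _
    obtain ⟨l, h3, h4⟩ := exists_int_between (hsep i i' hii j)
    have hGj := (hGc.iterate j).tendsto (z i)
    filter_upwards [((hR' (z i')).add_const (2 * Real.pi * ((l : ℝ) - 1))).eventually_lt
        (hGj.comp (hL' (z i))) h3,
      (hGj.comp (hR' (z i))).eventually_lt
        ((hL' (z i')).add_const (2 * Real.pi * (l : ℝ))) h4] with δ h5 h6
    exact ⟨l, h5, h6⟩
  obtain ⟨δ, h3, h4⟩ := (h1.and h2).exists
  exact ⟨s, p₀, q, hρp ⟨0, hn⟩, hq0, _, _, h3, h4⟩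

end Converse

/-! ### Borel measurability of finite cyclicity. -/

section Measurability

/-- Some member of the family of `f` with `|a| < ε` has `n` crossings with rotation number `ρ`. -/
def crossingSet (k : ℕ) (ρ ε : ℝ) (n : ℕ) : Set (Ck k) :=
  {f | ∃ (r a : ℝ) (p : ℤ) (q : ℕ), |a| < ε ∧ ρ = p / q ∧ HasCrossings (familyLift f r a) n p q}

theorem isOpen_crossingSet (k : ℕ) (ρ ε : ℝ) (n : ℕ) : IsOpen (crossingSet k ρ ε n) := by
  have h : crossingSet k ρ ε n = ⋃ (r : ℝ) (a : ℝ) (p : ℤ) (q : ℕ) (_ : |a| < ε)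
      (_ : ρ = p / q), {f : Ck k | HasCrossings (familyLift f r a) n p q} := by
    ext f
    simp only [crossingSet, Set.mem_ofPred_eq, Set.mem_iUnion, exists_prop]
  rw [h]
  refine isOpen_iUnion fun r => isOpen_iUnion fun a => isOpen_iUnion fun p => isOpen_iUnion fun q =>
    isOpen_iUnion fun _ => isOpen_iUnion fun _ => ?_
  exact (isOpen_hasCrossings k n p q).preimage (f := fun f : Ck k => (f, r, a)) (by fun_prop)

/-- Passing between orbits and crossings changes `r` but never `a`, so the bound `|a| < ε` is
respected in both directions. -/
theorem iSup_numAttracting_le_iff {k : ℕ} (hk : 1 ≤ k) (f : Ck k) {ε : ℝ} (hε : ε * ‖f‖ < 1)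
    (ρ : ℝ) (N : ℕ) :
    (⨆ (r : ℝ) (a : ℝ) (_ : HasRotationNumber (family f r a) ρ) (_ : |a| < ε),
      numAttracting (family f r a)) ≤ (N : ℕ∞) ↔ f ∉ crossingSet k ρ ε (N + 1) := by
  have hae : ∀ a : ℝ, |a| < ε → |a| * ‖f‖ < 1 := fun a ha =>
    lt_of_le_of_lt (mul_le_mul_of_nonneg_right ha.le (norm_nonneg f)) hε
  simp only [iSup_le_iff]
  constructor
  · rintro h ⟨r, a, p, q, ha, hρ, hc⟩
    obtain ⟨s, h1, h2⟩ := hc.exists_numAttracting hk (hae a ha) N.succ_pos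
    rw [← hρ] at h1
    have h3 := h2.trans (h s a h1 ha)
    have h4 : N + 1 ≤ N := by exact_mod_cast h3
    omega
  · intro h r a hρ ha
    by_contra hcon
    have h1 : ((N + 1 : ℕ) : ℕ∞) ≤ numAttracting (family f r a) := by
      push_cast
      exact Order.add_one_le_of_lt (not_le.1 hcon)
    obtain ⟨s, p, q, h2, h3⟩ := exists_hasCrossings hk (hae a ha) N.succ_pos hρ h1
    exact h ⟨s, a, p, q, ha, h2, h3⟩

theorem crossingSet_mono (k : ℕ) (ρ : ℝ) (n : ℕ) {ε ε' : ℝ} (h : ε ≤ ε') :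
    crossingSet k ρ ε n ⊆ crossingSet k ρ ε' n := by
  rintro f ⟨r, a, p, q, ha, h1⟩
  exact ⟨r, a, p, q, ha.trans_le h, h1⟩

theorem cyclicityAt_le_iff {k : ℕ} (hk : 1 ≤ k) (f : Ck k) (ρ : ℝ) (N : ℕ) :
    cyclicityAt (family f) ρ ≤ (N : ℕ∞) ↔
      ∃ m : ℕ, f ∉ crossingSet k ρ (1 / (m + 1)) (N + 1) := by
  have hsmall : ∀ᶠ ε in 𝓝[>] (0 : ℝ), ε * ‖f‖ < 1 := by
    have h1 : Tendsto (fun ε : ℝ => ε * ‖f‖) (𝓝[>] 0) (𝓝 0) :=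
      ((continuous_mul_const ‖f‖).tendsto' 0 0 (zero_mul _)).mono_left nhdsWithin_le_nhds
    exact h1.eventually_lt_const one_pos
  have hlim : cyclicityAt (family f) ρ ≤ (N : ℕ∞) ↔ ∀ᶠ ε in 𝓝[>] (0 : ℝ),
      (⨆ (r : ℝ) (a : ℝ) (_ : HasRotationNumber (family f r a) ρ) (_ : |a| < ε),
        numAttracting (family f r a)) ≤ (N : ℕ∞) := by
    constructor
    · intro h
      -- Values in `ℕ∞` are discrete at `N`: being below `N + 1` eventually is the same as being at
      -- most `N` eventually.
      have h1 : cyclicityAt (family f) ρ < (N : ℕ∞) + 1 :=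
        lt_of_le_of_lt h (by exact_mod_cast N.lt_succ_self)
      filter_upwards [eventually_lt_of_limsup_lt h1] with ε hε
      exact Order.le_of_lt_add_one hε
    · exact fun h => limsup_le_of_le (by isBoundedDefault) h
  rw [hlim]
  constructor
  · intro h
    obtain ⟨δ, hδ, h1⟩ := mem_nhdsGT_iff_exists_Ioo_subset.1 (h.and hsmall)
    obtain ⟨m, hm⟩ := exists_nat_one_div_lt (show (0 : ℝ) < δ from hδ)
    obtain ⟨h2, h3⟩ := h1 ⟨by positivity, hm⟩
    exact ⟨m, (iSup_numAttracting_le_iff hk f h3 ρ N).1 h2⟩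
  · rintro ⟨m, hm⟩
    filter_upwards [hsmall, Ioo_mem_nhdsGT (show (0 : ℝ) < 1 / (m + 1) by positivity)] with ε h1 h2
    exact (iSup_numAttracting_le_iff hk f h1 ρ N).2 fun h =>
      hm (crossingSet_mono k ρ (N + 1) h2.2.le h)

theorem measurableSet_ICFin {k : ℕ} (hk : 1 ≤ k) : MeasurableSet (ICFin k) := by
  refine MeasurableSet.iUnion fun ⟨N, _⟩ => ?_
  have h : ICBounded k N = ⋂ ρ : ℚ, ⋃ m : ℕ, (crossingSet k ρ (1 / (m + 1)) (N + 1))ᶜ := by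
    ext f
    simp only [ICBounded, Set.mem_ofPred_eq, cyclicityAt_le_iff hk, Set.mem_iInter, Set.mem_iUnion,
      Set.mem_compl_iff]
    -- Crossings force a rational rotation number, so irrational `ρ` impose no condition and a
    -- countable intersection suffices.
    refine ⟨fun h ρ => h ρ, fun h ρ => ?_⟩
    by_cases hρ : ∃ (p : ℤ) (q : ℕ), ρ = p / q
    · obtain ⟨p, q, rfl⟩ := hρ
      have h1 := h (p / q : ℚ)
      push_cast at h1
      exact h1
    · exact ⟨0, fun ⟨r, a, p, q, _, h1, _⟩ => hρ ⟨p, q, h1⟩⟩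
  rw [h]
  exact MeasurableSet.iInter fun ρ => MeasurableSet.iUnion fun m =>
    (isOpen_crossingSet k _ _ _).measurableSet.compl

end Measurability

/-! ### Averaging near a rational rotation. -/

theorem familyLift_iterate_eq_sum {k : ℕ} (f : Ck k) (r a x : ℝ) (m : ℕ) :
    (familyLift f r a)^[m] x = x + 2 * Real.pi * r * m +
      a * ∑ j ∈ Finset.range m, f ((familyLift f r a)^[j] x) := by
  induction m with
  | zero => simp
  | succ m ih =>
    rw [iterate_succ_apply', Finset.sum_range_succ]
    conv_lhs => unfold familyLift
    change (familyLift f r a)^[m] x + (2 * Real.pi * r + a * f ((familyLift f r a)^[m] x)) = _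
    push_cast
    linarith

/-- As `a → 0+`, the points of an orbit segment tend to the `q` translates by `2π/q`. The
displacement divided by `a` therefore tends to the sum over translates minus `q c`, which has
opposite signs at `u i` and `v i`. -/
theorem not_cyclicityAt_le {k : ℕ} (hk : 1 ≤ k) (f : Ck k) (N : ℕ) {q : ℕ} (hq : 0 < q) (c : ℝ)
    (u v : Fin (N + 1) → ℝ) (huv : ∀ i, u i < v i) (hord : ∀ i i', i < i' → v i < u i')
    (hper : ∀ i i', v i' - u i < 2 * Real.pi / q)
    (hu : ∀ i, q * c < ∑ j ∈ Finset.range q, f (u i + 2 * Real.pi * j / q))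
    (hv : ∀ i, ∑ j ∈ Finset.range q, f (v i + 2 * Real.pi * j / q) < q * c) :
    ¬ cyclicityAt (family f) (1 / q) ≤ (N : ℕ∞) := by
  have hpi := Real.two_pi_pos
  have hq' : (0 : ℝ) < q := by exact_mod_cast hq
  rw [cyclicityAt_le_iff hk]
  rintro ⟨m, hm⟩
  apply hm
  -- The correction `-ac/(2π)` lowers the displacement over `q` steps by exactly `a q c`, placing
  -- the level `q c` at zero.
  set Γ : ℝ → ℝ → ℝ := fun a => familyLift f (1 / q - a * c / (2 * Real.pi)) a with hΓ
  set G : ℝ → ℝ := fun x => x + 2 * Real.pi / q with hG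
  have hGj : ∀ j : ℕ, ∀ x, G^[j] x = x + 2 * Real.pi * j / q := by
    intro j x
    induction j with
    | zero => simp
    | succ j ih =>
      rw [iterate_succ_apply', ih, hG]
      push_cast
      ring
  have hΓG : ∀ j x, Tendsto (fun a => (Γ a)^[j] x) (𝓝[>] 0) (𝓝 (G^[j] x)) := by
    intro j x
    have h1 := tendsto_familyLift_iterate (f, 1 / (q : ℝ), (0 : ℝ)) j x
    have h2 : Tendsto (fun a : ℝ => (f, 1 / (q : ℝ) - a * c / (2 * Real.pi), a)) (𝓝[>] 0)
        (𝓝 (f, 1 / (q : ℝ), (0 : ℝ))) := by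
      refine (Continuous.tendsto' (by fun_prop) 0 _ ?_).mono_left nhdsWithin_le_nhds
      simp
    have h3 : familyLift f (1 / (q : ℝ)) 0 = G := by
      funext y
      simp only [hG, familyLift]
      ring
    have h4 := h1.comp h2
    simp only [h3] at h4
    exact h4
  have hsum : ∀ x, Tendsto (fun a => ∑ j ∈ Finset.range q, f ((Γ a)^[j] x)) (𝓝[>] 0)
      (𝓝 (∑ j ∈ Finset.range q, f (x + 2 * Real.pi * j / q))) := by
    intro x
    refine tendsto_finsetSum _ fun j _ => ?_
    rw [← hGj]
    exact (f.contDiff.continuous.tendsto _).comp (hΓG j x)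
  have hform : ∀ a x, (Γ a)^[q] x = x + 2 * Real.pi * (1 : ℤ) +
      a * (∑ j ∈ Finset.range q, f ((Γ a)^[j] x) - q * c) := by
    intro a x
    rw [hΓ]
    simp only
    rw [familyLift_iterate_eq_sum]
    field_simp
    push_cast
    ring
  have hsep : Separated G q u v := by
    intro i i' hii j hj
    have hjq : (j : ℝ) + 1 ≤ q := by exact_mod_cast hj
    have h0 : 2 * Real.pi / q ≤ 2 * Real.pi := div_le_self hpi.le (by
      exact_mod_cast hq)
    have h1 : 2 * Real.pi * j / q + 2 * Real.pi / q ≤ 2 * Real.pi := by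
      rw [← add_div, div_le_iff₀ hq']
      nlinarith
    have h2 : 0 ≤ 2 * Real.pi * j / q := by positivity
    simp only [hGj]
    -- All intervals fit in a window of length less than `2π/q`. For `j ≥ 1` the rotated interval
    -- lies beyond that window and before its next `2π`-translate; for `j = 0` the order of the
    -- indices decides.
    by_cases hc : j = 0 ∧ i < i'
    · obtain ⟨rfl, hlt⟩ := hc
      refine ⟨0, ?_, ?_⟩
      · push_cast
        linarith [hper i i']
      · simpa using hord i i' hlt
    · refine ⟨1, ?_, ?_⟩
      · rcases Nat.eq_zero_or_pos j with rfl | hj0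
        · have hlt : i' < i := lt_of_le_of_ne (not_lt.1 fun h => hc ⟨rfl, h⟩) (Ne.symm hii)
          simpa using hord i' i hlt
        · have h3 : 2 * Real.pi / q ≤ 2 * Real.pi * j / q := by
            have : (1 : ℝ) ≤ j := by exact_mod_cast hj0
            exact div_le_div_of_nonneg_right (le_mul_of_one_le_right hpi.le this) hq'.le
          push_cast
          linarith [hper i i']
      · push_cast
        linarith [hper i' i]
  have hcr : ∀ᶠ a in 𝓝[>] (0 : ℝ), ∀ i, IsCrossing (Γ a) 1 q (u i) (v i) := by
    rw [eventually_all]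
    intro i
    filter_upwards [(hsum (u i)).eventually_const_lt (hu i),
      (hsum (v i)).eventually_lt_const (hv i), self_mem_nhdsWithin] with a h1 h2 h3
    have h3 : 0 < a := h3
    refine ⟨huv i, ?_, ?_⟩
    · rw [hform]
      have := mul_pos h3 (sub_pos.2 h1)
      linarith
    · rw [hform]
      have := mul_neg_of_pos_of_neg h3 (sub_neg.2 h2)
      linarith
  have hsmall : ∀ᶠ a in 𝓝[>] (0 : ℝ), a ∈ Set.Ioo (0 : ℝ) (1 / (m + 1)) :=
    Ioo_mem_nhdsGT (by positivity)
  obtain ⟨a, h1, h2, h3⟩ := (hcr.and ((hsep.eventually hΓG).and hsmall)).exists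
  refine ⟨_, a, 1, q, ?_, by simp, hq, u, v, h1, h2⟩
  rw [abs_of_pos h3.1]
  exact h3.2

/-! ### Fourier bounds for averages over translates. -/

section Fourier

open Complex in
theorem sum_exp_eq {q : ℕ} (hq : 0 < q) (n : ℤ) :
    ∑ j ∈ Finset.range q, exp (2 * Real.pi * I * n * j / q) = if (q : ℤ) ∣ n then (q : ℂ) else 0 := by
  have hq' : (q : ℂ) ≠ 0 := by exact_mod_cast hq.ne'
  have hpi : (2 * Real.pi * I : ℂ) ≠ 0 := two_pi_I_ne_zero
  have h1 : ∀ j : ℕ, exp (2 * Real.pi * I * n * j / q) = exp (2 * Real.pi * I * n / q) ^ j := by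
    intro j
    rw [← exp_nat_mul]
    congr 1
    ring
  simp only [h1]
  split_ifs with h
  · obtain ⟨m, rfl⟩ := h
    have h2 : exp (2 * Real.pi * I * ((q * m : ℤ) : ℂ) / q) = 1 := by
      rw [exp_eq_one_iff]
      refine ⟨m, ?_⟩
      push_cast
      field_simp
    rw [h2]
    simp
  · have h2 : exp (2 * Real.pi * I * n / q) ≠ 1 := by
      rw [Ne, exp_eq_one_iff]
      rintro ⟨m, hm⟩
      apply h
      refine ⟨m, ?_⟩
      rw [div_eq_iff hq'] at hm
      have h3 : (n : ℂ) = q * m := mul_left_cancel₀ hpi (by rw [hm]; ring)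
      exact_mod_cast h3
    have h3 : exp (2 * Real.pi * I * n / q) ^ q = 1 := by
      rw [← h1, exp_eq_one_iff]
      refine ⟨n, ?_⟩
      field_simp
    rw [geom_sum_eq h2, h3, sub_self, zero_div]

theorem sum_cos_eq {q : ℕ} (hq : 0 < q) (n : ℕ) (x : ℝ) :
    ∑ j ∈ Finset.range q, Real.cos (n * (x + 2 * Real.pi * j / q)) =
      if q ∣ n then q * Real.cos (n * x) else 0 := by
  have h := congrArg (fun w => (Complex.exp (n * x * Complex.I) * w).re) (sum_exp_eq hq n)
  simp only [Finset.mul_sum, Complex.re_sum, ← Complex.exp_add] at h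
  have h1 : ∀ j : ℕ, (Complex.exp (n * x * Complex.I +
      2 * Real.pi * Complex.I * (n : ℤ) * j / q)).re =
      Real.cos (n * (x + 2 * Real.pi * j / q)) := by
    intro j
    rw [← Complex.exp_ofReal_mul_I_re]
    congr 2
    push_cast
    ring
  have h2 : (Complex.exp (n * x * Complex.I)).re = Real.cos (n * x) := by
    rw [← Complex.exp_ofReal_mul_I_re]
    push_cast
    rfl
  simp only [h1, Int.natCast_dvd_natCast] at h
  rw [h]
  split_ifs
  · rw [← h2, ← Complex.ofReal_natCast q, Complex.re_mul_ofReal, mul_comm]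
  · simp

variable {k : ℕ}

/-- The `j`-th derivative as a complex-valued continuous function on the circle. -/
def Ck.derivC (g : Ck k) (j : Fin (k + 1)) : C(S, ℂ) :=
  ⟨fun x => (g.derivOn j x : ℂ), Complex.continuous_ofReal.comp (g.derivOn j).continuous⟩

theorem Ck.derivC_coe (g : Ck k) (j : Fin (k + 1)) (x : ℝ) :
    g.derivC j (x : S) = ((iteratedDeriv j (g : ℝ → ℝ) x : ℝ) : ℂ) := rfl

theorem fourierCoeff_derivC (g : Ck k) (j : Fin (k + 1)) (n : ℤ) :
    fourierCoeff (g.derivC j) n = fourierCoeffOn (lt_add_of_pos_right 0 Real.two_pi_pos)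
      (fun x => ((iteratedDeriv j (g : ℝ → ℝ) x : ℝ) : ℂ)) n := by
  rw [← fourierCoeff_liftIco_eq]
  congr 1
  funext y
  obtain ⟨x, hx, rfl⟩ := AddCircle.eq_coe_Ico y
  rw [AddCircle.liftIco_zero_coe_apply hx, Ck.derivC_coe]

/-- Integration by parts; the boundary term vanishes by periodicity. -/
theorem norm_fourierCoeff_derivC_succ (g : Ck k) {j : ℕ} (hj : j < k) (n : ℤ) :
    ‖fourierCoeff (g.derivC ⟨j + 1, by omega⟩) n‖ =
      |(n : ℝ)| * ‖fourierCoeff (g.derivC ⟨j, by omega⟩) n‖ ∨ n = 0 := by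
  by_cases hn : n = 0
  · exact Or.inr hn
  left
  have hcont : Continuous (iteratedDeriv (j + 1) (g : ℝ → ℝ)) :=
    g.contDiff.continuous_iteratedDeriv _ (by exact_mod_cast hj)
  have hdiff : Differentiable ℝ (iteratedDeriv j (g : ℝ → ℝ)) :=
    g.contDiff.differentiable_iteratedDeriv _ (by exact_mod_cast hj)
  have hder : ∀ x : ℝ, HasDerivAt (fun x => ((iteratedDeriv j (g : ℝ → ℝ) x : ℝ) : ℂ))
      ((iteratedDeriv (j + 1) (g : ℝ → ℝ) x : ℝ) : ℂ) x := fun x => by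
    have h1 := (hdiff x).hasDerivAt
    rw [← iteratedDeriv_succ] at h1
    exact h1.ofReal_comp
  have h := fourierCoeffOn_of_hasDerivAt (lt_add_of_pos_right (0 : ℝ) Real.two_pi_pos) hn
    (fun x _ => hder x) ((Complex.continuous_ofReal.comp hcont).intervalIntegrable _ _)
  rw [fourierCoeff_derivC, fourierCoeff_derivC]
  simp only
  rw [h, g.periodic_iteratedDeriv j 0, sub_self, mul_zero, zero_sub, norm_mul, norm_neg, norm_mul,
    norm_div, norm_one]
  have hn' : (0 : ℝ) < |(n : ℝ)| := by positivity
  have h1 : ‖(-2 * Real.pi * Complex.I * n : ℂ)‖ = 2 * Real.pi * |(n : ℝ)| := by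
    simp [abs_of_pos Real.pi_pos]
  have h2 : ‖(((0 + 2 * Real.pi : ℝ) : ℂ) - (0 : ℝ))‖ = 2 * Real.pi := by
    rw [zero_add, Complex.ofReal_zero, sub_zero, Complex.norm_real, Real.norm_eq_abs,
      abs_of_pos Real.two_pi_pos]
  rw [h1, h2]
  have := Real.two_pi_pos
  field_simp

theorem norm_fourierCoeff_derivC (g : Ck k) {n : ℤ} (hn : n ≠ 0) (j : ℕ) (hj : j ≤ k) :
    ‖fourierCoeff (g.derivC ⟨j, by omega⟩) n‖ =
      |(n : ℝ)| ^ j * ‖fourierCoeff (g.derivC 0) n‖ := by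
  induction j with
  | zero => simp
  | succ j ih =>
    rw [(norm_fourierCoeff_derivC_succ g (by omega) n).resolve_right hn, ih (by omega)]
    ring

theorem summable_sq_fourierCoeff (f : C(S, ℂ)) : Summable fun n => ‖fourierCoeff f n‖ ^ 2 := by
  have h := (hasSum_sq_fourierCoeff (ContinuousMap.toLp (E := ℂ) 2 AddCircle.haarAddCircle ℂ f)).summable
  simpa only [fourierCoeff_toLp] using h

theorem summable_mul_inv_sq {c : ℤ → ℝ} (hc0 : ∀ n, 0 ≤ c n) (hc : Summable fun n => c n ^ 2) :
    Summable fun n : ℤ => c n / (n : ℝ) ^ 2 := by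
  have h1 : Summable fun n : ℤ => 1 / (n : ℝ) ^ 4 := Real.summable_one_div_int_pow.2 (by norm_num)
  refine Summable.of_nonneg_of_le (fun n => div_nonneg (hc0 n) (sq_nonneg _)) (fun n => ?_)
    (hc.add h1)
  have h2 : 1 / (n : ℝ) ^ 4 = (1 / (n : ℝ) ^ 2) ^ 2 := by
    rw [div_pow, one_pow, ← pow_mul]
  rw [h2, div_eq_mul_one_div]
  nlinarith [sq_nonneg (c n - 1 / (n : ℝ) ^ 2), mul_nonneg (hc0 n)
    (show 0 ≤ 1 / (n : ℝ) ^ 2 by positivity)]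

/-- Averaging leaves the modes `q m`, whose coefficients are those of the `k`-th derivative divided
by `|q m|^k`. The power `q^k` factors out, and `k ≥ 2` gives `|m|^k ≥ m²`. On the right the term `m
= 0` is zero, as division by zero is; on the left it is the subtracted mean. -/
theorem sum_translates_le (hk : 2 ≤ k) (g : Ck k) {q : ℕ} (hq : 0 < q) (x : ℝ) :
    (q : ℝ) ^ k * |(∑ j ∈ Finset.range q, g (x + 2 * Real.pi * j / q)) / q -
      (fourierCoeff (g.derivC 0) 0).re| ≤
      ∑' m : ℤ, ‖fourierCoeff (g.derivC (Fin.last k)) (q * m)‖ / (m : ℝ) ^ 2 := by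
  set c : ℤ → ℝ := fun n => ‖fourierCoeff (g.derivC (Fin.last k)) n‖ with hc
  set α := fourierCoeff (g.derivC 0) with hα
  have hq0 : (0 : ℝ) < q := by exact_mod_cast hq
  have hq' : (q : ℂ) ≠ 0 := by exact_mod_cast hq.ne'
  have hc2 : Summable fun n => c n ^ 2 := summable_sq_fourierCoeff _
  have hαc : ∀ n : ℤ, n ≠ 0 → ‖α n‖ = c n / |(n : ℝ)| ^ k := fun n hn => by
    have hn' : (0 : ℝ) < |(n : ℝ)| := by positivity
    rw [eq_div_iff (by positivity), mul_comm]
    exact (norm_fourierCoeff_derivC g hn k le_rfl).symm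
  have hαle : ∀ n : ℤ, n ≠ 0 → ‖α n‖ ≤ c n / (n : ℝ) ^ 2 := fun n hn => by
    have hn' : (1 : ℝ) ≤ |(n : ℝ)| := by exact_mod_cast Int.one_le_abs hn
    rw [hαc n hn, ← sq_abs (n : ℝ)]
    have := pow_le_pow_right₀ hn' hk
    gcongr
  have hsum : Summable α := by
    refine Summable.of_norm_bounded_eventually
      (summable_mul_inv_sq (fun n => norm_nonneg _) hc2) ?_
    filter_upwards [(Set.finite_singleton (0 : ℤ)).compl_mem_cofinite] with n hn
    exact hαle n hn
  have hinj : Injective fun m : ℤ => (q : ℤ) * m := fun a b hab =>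
    mul_left_cancel₀ (by exact_mod_cast hq.ne') hab
  have hpt : ∀ y : ℝ, HasSum (fun n : ℤ => α n * Complex.exp (n * y * Complex.I)) (g y : ℂ) := by
    intro y
    have h1 := has_pointwise_sum_fourier_series_of_summable hsum (y : S)
    have h2 : g.derivC 0 (y : S) = (g y : ℂ) := by
      rw [Ck.derivC_coe]
      simp
    rw [h2] at h1
    refine h1.congr_fun fun n => ?_
    rw [fourier_coe_apply, smul_eq_mul]
    congr 2
    push_cast
    have : (Real.pi : ℂ) ≠ 0 := by exact_mod_cast Real.pi_ne_zero
    field_simp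
  have havg : HasSum (fun n : ℤ => α n * Complex.exp (n * x * Complex.I) *
      if (q : ℤ) ∣ n then (q : ℂ) else 0)
      (∑ j ∈ Finset.range q, (g (x + 2 * Real.pi * j / q) : ℂ)) := by
    refine (hasSum_sum fun (j : ℕ) _ => hpt (x + 2 * Real.pi * j / q)).congr_fun fun n => ?_
    rw [← sum_exp_eq hq, Finset.mul_sum]
    refine Finset.sum_congr rfl fun j _ => ?_
    rw [mul_assoc, ← Complex.exp_add]
    congr 2
    push_cast
    ring
  rw [← hinj.hasSum_iff (fun n hn => by
    rw [if_neg, mul_zero]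
    rintro ⟨m, rfl⟩
    exact hn ⟨m, rfl⟩)] at havg
  have havg' := (havg.sub (hasSum_ite_eq (0 : ℤ) (q * α 0))).div_const (q : ℂ)
  have hbd : HasSum (fun m : ℤ => (1 / (q : ℝ) ^ k) * (c (q * m) / (m : ℝ) ^ 2))
      ((1 / (q : ℝ) ^ k) * ∑' m : ℤ, c (q * m) / (m : ℝ) ^ 2) := by
    refine (Summable.hasSum ?_).mul_left _
    exact summable_mul_inv_sq (c := fun m => c (q * m)) (fun n => norm_nonneg _)
      (hc2.comp_injective hinj)
  have hle := havg'.norm_le_of_bounded hbd fun m => by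
    by_cases hm : m = 0
    · subst hm
      simp [mul_comm]
    · have hm' : (1 : ℝ) ≤ |(m : ℝ)| := by exact_mod_cast Int.one_le_abs hm
      have hqm : (q : ℤ) * m ≠ 0 := mul_ne_zero (by exact_mod_cast hq.ne') hm
      simp only [comp_apply, dvd_mul_right, if_true, hm, if_false, sub_zero]
      rw [mul_div_assoc, div_self hq', mul_one, norm_mul, hαc _ hqm]
      have h1 : ‖Complex.exp (((q * m : ℤ) : ℂ) * x * Complex.I)‖ = 1 := by
        have := Complex.norm_exp_ofReal_mul_I (((q * m : ℤ) : ℝ) * x)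
        push_cast at this ⊢
        exact this
      rw [h1, mul_one]
      push_cast
      rw [abs_mul, abs_of_pos hq0, mul_pow, ← sq_abs (m : ℝ)]
      have h2 := pow_le_pow_right₀ hm' hk
      have h3 : 0 ≤ c (q * m) := norm_nonneg _
      calc c (q * m) / ((q : ℝ) ^ k * |(m : ℝ)| ^ k)
          ≤ c (q * m) / ((q : ℝ) ^ k * |(m : ℝ)| ^ 2) := by gcongr
        _ = 1 / (q : ℝ) ^ k * (c (q * m) / |(m : ℝ)| ^ 2) := by field_simp
  have hre : |(∑ j ∈ Finset.range q, g (x + 2 * Real.pi * j / q)) / q - (α 0).re| ≤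
      ‖((∑ j ∈ Finset.range q, (g (x + 2 * Real.pi * j / q) : ℂ)) - q * α 0) / q‖ := by
    refine le_trans (le_of_eq ?_) (Complex.abs_re_le_norm _)
    congr 1
    rw [sub_div, mul_div_cancel_left₀ _ hq', Complex.sub_re]
    congr 1
    rw [← Complex.ofReal_sum, ← Complex.ofReal_natCast, ← Complex.ofReal_div, Complex.ofReal_re]
  have h4 := hre.trans hle
  rw [one_div, ← div_eq_inv_mul, le_div_iff₀ (by positivity)] at h4
  linarith

/-- Sum the lower bound over `q ∈ B` and exchange the sums. For fixed `m ≠ 0` the map `q ↦ q m` is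
injective, so Cauchy–Schwarz bounds the inner sum by `√(|B| C)`. This gives `|B| η ≤ √(|B| C) Z`. -/
theorem card_mul_sq_le {c : ℤ → ℝ} (hc0 : ∀ n, 0 ≤ c n) (hc : Summable fun n => c n ^ 2) {η : ℝ}
    (hη : 0 ≤ η) (B : Finset ℕ)
    (hB : ∀ q ∈ B, 0 < q ∧ η ≤ ∑' m : ℤ, c (q * m) / (m : ℝ) ^ 2) :
    B.card * η ^ 2 ≤ (∑' m : ℤ, 1 / (m : ℝ) ^ 2) ^ 2 * ∑' n, c n ^ 2 := by
  set Z := ∑' m : ℤ, 1 / (m : ℝ) ^ 2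
  set C := ∑' n, c n ^ 2
  have hZ : Summable fun m : ℤ => 1 / (m : ℝ) ^ 2 := Real.summable_one_div_int_pow.2 (by norm_num)
  have hC0 : 0 ≤ C := tsum_nonneg fun n => sq_nonneg _
  rcases B.card.eq_zero_or_pos with h0 | hpos
  · rw [h0]
    simp only [Nat.cast_zero, zero_mul]
    positivity
  have hpos' : (0 : ℝ) < B.card := by exact_mod_cast hpos
  have hsq : ∀ m : ℤ, m ≠ 0 → ∑ q ∈ B, c (q * m) ≤ Real.sqrt (B.card * C) := by
    intro m hm
    refine Real.le_sqrt_of_sq_le (sq_sum_le_card_mul_sum_sq.trans ?_)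
    gcongr
    have hinj : Injective fun q : ℕ => (q : ℤ) * m := fun a b hab => by
      exact_mod_cast mul_right_cancel₀ hm hab
    have h := hc.sum_le_tsum (B.map ⟨_, hinj⟩) fun n _ => sq_nonneg _
    rwa [Finset.sum_map] at h
  have hs : ∀ q ∈ B, Summable fun m : ℤ => c (q * m) / (m : ℝ) ^ 2 := fun q hq => by
    refine summable_mul_inv_sq (c := fun m => c (q * m)) (fun n => hc0 _) (hc.comp_injective ?_)
    exact fun a b hab => mul_left_cancel₀ (by exact_mod_cast (hB q hq).1.ne') hab
  have h1 : B.card * η ≤ Real.sqrt (B.card * C) * Z := by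
    calc (B.card : ℝ) * η = ∑ q ∈ B, η := by simp
      _ ≤ ∑ q ∈ B, ∑' m : ℤ, c (q * m) / (m : ℝ) ^ 2 := Finset.sum_le_sum fun q hq => (hB q hq).2
      _ = ∑' m : ℤ, ∑ q ∈ B, c (q * m) / (m : ℝ) ^ 2 := (Summable.tsum_finsetSum hs).symm
      _ ≤ ∑' m : ℤ, Real.sqrt (B.card * C) * (1 / (m : ℝ) ^ 2) := by
        refine Summable.tsum_le_tsum (fun m => ?_) (summable_sum hs) (hZ.mul_left _)
        by_cases hm : m = 0
        · subst hm
          simp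
        · rw [← Finset.sum_div, mul_one_div]
          exact div_le_div_of_nonneg_right (hsq m hm) (sq_nonneg _)
      _ = Real.sqrt (B.card * C) * Z := tsum_mul_left
  have h2 := pow_le_pow_left₀ (by positivity) h1 2
  rw [mul_pow, mul_pow, Real.sq_sqrt (by positivity)] at h2
  have h3 : (B.card : ℝ) * (B.card * η ^ 2) ≤ B.card * (Z ^ 2 * C) := by nlinarith
  exact le_of_mul_le_mul_left h3 hpos'

theorem exists_card_le (hk : 2 ≤ k) (g : Ck k) : ∃ m₀ K : ℝ, ∀ η : ℝ, 0 ≤ η → ∀ B : Finset ℕ,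
    (∀ q ∈ B, 0 < q ∧ ∃ x, η < (q : ℝ) ^ k *
      |(∑ j ∈ Finset.range q, g (x + 2 * Real.pi * j / q)) / q - m₀|) →
    B.card * η ^ 2 ≤ K :=
  ⟨(fourierCoeff (g.derivC 0) 0).re, _, fun _ hη B hB =>
    card_mul_sq_le (fun _ => norm_nonneg _) (summable_sq_fourierCoeff (g.derivC (Fin.last k))) hη B
      fun q hq => by
        obtain ⟨hq0, x, hx⟩ := hB q hq
        exact ⟨hq0, hx.le.trans (sum_translates_le hk g hq0 x)⟩⟩

end Fourier

/-! ### Completeness of `C^k(S)` and lacunary series. -/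

namespace Ck

variable {k : ℕ}

/-- Evaluation at a point, as an additive map. -/
def evalHom (k : ℕ) (x : ℝ) : Ck k →+ ℝ where
  toFun f := f x
  map_zero' := rfl
  map_add' _ _ := rfl

theorem continuous_evalHom (x : ℝ) : Continuous (evalHom k x) :=
  continuous_eval.comp (Continuous.prodMk_left x)

/-- The pointwise sum of an absolutely convergent series in `C^k(S)`. -/
def pointwiseTsum (u : ℕ → Ck k) (hu : Summable fun i => ‖u i‖) : Ck k :=
  ⟨fun x => ∑' i, u i x, by
    constructor
    · refine contDiff_tsum (fun i => (u i).contDiff) (fun _ _ => hu) fun j i x hj => ?_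
      rw [norm_iteratedFDeriv_eq_norm_iteratedDeriv]
      exact (u i).abs_iteratedDeriv_le j (by exact_mod_cast hj) x
    · intro x
      exact tsum_congr fun i => (u i).periodic x⟩

theorem norm_pointwiseTsum_le (u : ℕ → Ck k) (hu : Summable fun i => ‖u i‖) :
    ‖pointwiseTsum u hu‖ ≤ ∑' i, ‖u i‖ := by
  refine norm_le_of_forall _ (tsum_nonneg fun i => norm_nonneg _) fun j hj x => ?_
  have hb : ∀ (j : ℕ) (i : ℕ) (x : ℝ), (j : ℕ∞) ≤ (k : ℕ∞) →
      ‖iteratedFDeriv ℝ j (u i : ℝ → ℝ) x‖ ≤ ‖u i‖ := fun j i x hj => by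
    rw [norm_iteratedFDeriv_eq_norm_iteratedDeriv]
    exact (u i).abs_iteratedDeriv_le j (by exact_mod_cast hj) x
  rw [← Real.norm_eq_abs, ← norm_iteratedFDeriv_eq_norm_iteratedDeriv]
  have hj' : (j : ℕ∞) ≤ (k : ℕ∞) := by exact_mod_cast hj
  have h := iteratedFDeriv_tsum_apply (fun i => (u i).contDiff) (fun _ _ => hu) hb hj' x
  change ‖iteratedFDeriv ℝ j (fun y => ∑' i, u i y) x‖ ≤ _
  rw [h]
  exact tsum_of_norm_bounded hu.hasSum fun i => hb j i x hj'

instance instCompleteSpace : CompleteSpace (Ck k) := by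
  refine NormedAddCommGroup.completeSpace_of_summable_imp_tendsto fun u hu => ?_
  refine ⟨pointwiseTsum u hu, ?_⟩
  rw [tendsto_iff_norm_sub_tendsto_zero]
  refine squeeze_zero (fun n => norm_nonneg _) (fun n => ?_) (tendsto_sum_nat_add fun i => ‖u i‖)
  have hun : Summable fun i => ‖u (i + n)‖ := (summable_nat_add_iff n).2 hu
  have heq : pointwiseTsum u hu - ∑ i ∈ Finset.range n, u i =
      pointwiseTsum (fun i => u (i + n)) hun := by
    rw [sub_eq_iff_eq_add']
    refine Subtype.ext (funext fun x => ?_)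
    change ∑' i, u i x = evalHom k x (∑ i ∈ Finset.range n, u i + pointwiseTsum _ hun)
    rw [map_add, map_sum]
    have hs : Summable fun i => u i x := Summable.of_norm_bounded hu fun i => by
      have := (u i).abs_iteratedDeriv_le 0 (Nat.zero_le k) x
      rwa [iteratedDeriv_zero] at this
    exact (hs.sum_add_tsum_nat_add n).symm
  rw [norm_sub_rev, heq]
  exact norm_pointwiseTsum_le _ hun

/-- The function `x ↦ M⁻ᵏ cos(Mx)`. -/
def harmonic (k M : ℕ) : Ck k :=
  ⟨fun x => ((M : ℝ) ^ k)⁻¹ * Real.cos (M * x), by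
    constructor
    · have h : ContDiff ℝ (k : ℕ∞) fun x : ℝ => Real.cos (M * x) :=
        Real.contDiff_cos.comp (contDiff_const.mul contDiff_id)
      exact contDiff_const.mul h
    · intro x
      simp only
      rw [mul_add, Real.cos_add_nat_mul_two_pi]⟩

theorem harmonic_apply (k M : ℕ) (x : ℝ) :
    harmonic k M x = ((M : ℝ) ^ k)⁻¹ * Real.cos (M * x) := rfl

theorem norm_harmonic_le (hk : 1 ≤ k) (M : ℕ) : ‖harmonic k M‖ ≤ 1 := by
  refine norm_le_of_forall _ zero_le_one fun j hj x => ?_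
  have h1 : (harmonic k M : ℝ → ℝ) = fun x => ((M : ℝ) ^ k)⁻¹ * Real.cos (M * x) := rfl
  rw [h1, iteratedDeriv_const_mul_field, iteratedDeriv_comp_const_mul Real.contDiff_cos, abs_mul,
    abs_mul, abs_of_nonneg (by positivity), abs_of_nonneg (by positivity), ← mul_assoc]
  refine mul_le_one₀ ?_ (abs_nonneg _) (Real.abs_iteratedDeriv_cos_le_one j _)
  -- For `M = 0` the coefficient is `(0 ^ k)⁻¹ = 0`.
  rcases M.eq_zero_or_pos with rfl | hM
  · simp [zero_pow (by omega : k ≠ 0)]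
  · have hM' : (1 : ℝ) ≤ M := by exact_mod_cast hM
    rw [inv_mul_le_iff₀ (by positivity), mul_one]
    exact pow_le_pow_right₀ hM' hj

/-- The lacunary series `∑ᵢ 2⁻ⁱ Mᵢ⁻ᵏ cos(Mᵢ x)` with `Mᵢ = (i + 1) Qᵢ`. -/
def lacunary (k : ℕ) (Q : ℕ → ℕ) : Ck k :=
  ∑' i : ℕ, (1 / 2 : ℝ) ^ i • harmonic k ((i + 1) * Q i)

theorem summable_lacunary (hk : 1 ≤ k) (Q : ℕ → ℕ) :
    Summable fun i : ℕ => (1 / 2 : ℝ) ^ i • harmonic k ((i + 1) * Q i) := by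
  refine Summable.of_norm_bounded summable_geometric_two fun i => ?_
  rw [norm_smul, norm_pow, Real.norm_of_nonneg (by norm_num)]
  exact mul_le_of_le_one_right (by positivity) (norm_harmonic_le hk _)

theorem hasSum_lacunary_apply (hk : 1 ≤ k) (Q : ℕ → ℕ) (x : ℝ) :
    HasSum (fun i : ℕ => (1 / 2 : ℝ) ^ i * harmonic k ((i + 1) * Q i) x) (lacunary k Q x) :=
  (summable_lacunary hk Q).hasSum.map (evalHom k x) (continuous_evalHom x)

end Ck

/-! ### Lacunary frequencies and the surviving harmonic. -/

/-- The left endpoints of the blocks from which frequencies are drawn. -/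
def blockStart (i : ℕ) : ℕ := 16 ^ i * i.factorial

theorem blockStart_pos (i : ℕ) : 0 < blockStart i := by
  unfold blockStart
  positivity

theorem blockStart_succ (i : ℕ) : blockStart (i + 1) = 16 * ((i + 1) * blockStart i) := by
  unfold blockStart
  rw [Nat.factorial_succ]
  ring

theorem monotone_blockStart : Monotone blockStart := monotone_nat_of_le_succ fun i => by
  rw [blockStart_succ]
  nlinarith [blockStart_pos i]

/-- The factorial in `blockStart` absorbs the multiplier `i + 1`. The factor `16` pays for the block
ratio `2` and leaves a gap of `8`. -/
theorem mul_le_of_mem_block {Q : ℕ → ℕ} (hQ : ∀ i, Q i ∈ Set.Ico (blockStart i) (2 * blockStart i))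
    {i j : ℕ} (hij : i < j) : 8 * ((i + 1) * Q i) ≤ Q j := by
  have h1 := (hQ i).2
  have h2 := (hQ j).1
  have h3 := monotone_blockStart (Nat.succ_le_of_lt hij)
  rw [Nat.succ_eq_add_one, blockStart_succ] at h3
  have h4 : (i + 1) * Q i ≤ (i + 1) * (2 * blockStart i) := Nat.mul_le_mul_left _ h1.le
  nlinarith

/-- Frequencies `Mᵢ` with `i < j` are positive and below `Qⱼ`, hence not multiples of it, and
cancel. Those with `i > j` are at least `8 Mⱼ`, so their amplitudes lose a factor `8` besides the
geometric one, whether or not `Qⱼ` divides them. -/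
theorem sum_translates_lacunary {k : ℕ} (hk : 1 ≤ k) {Q : ℕ → ℕ}
    (hQ : ∀ i, Q i ∈ Set.Ico (blockStart i) (2 * blockStart i)) (j : ℕ) (x : ℝ) :
    |∑ l ∈ Finset.range (Q j), Ck.lacunary k Q (x + 2 * Real.pi * l / Q j) -
      Q j * ((1 / 2) ^ j * ((((j + 1) * Q j : ℕ) : ℝ) ^ k)⁻¹ *
        Real.cos (((j + 1) * Q j : ℕ) * x))| ≤
      Q j * ((1 / 2) ^ j * ((((j + 1) * Q j : ℕ) : ℝ) ^ k)⁻¹) / 8 := by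
  have hQpos : ∀ i, 0 < Q i := fun i => (blockStart_pos i).trans_le (hQ i).1
  set q := Q j with hq
  set A : ℝ := (1 / 2) ^ j * ((((j + 1) * q : ℕ) : ℝ) ^ k)⁻¹ with hA
  have hq0 : (0 : ℝ) < q := by exact_mod_cast hQpos j
  have hM0 : (0 : ℝ) < (((j + 1) * q : ℕ) : ℝ) := by
    exact_mod_cast Nat.mul_pos j.succ_pos (hQpos j)
  set T : ℕ → ℝ := fun i => ∑ l ∈ Finset.range q,
    (1 / 2 : ℝ) ^ i * Ck.harmonic k ((i + 1) * Q i) (x + 2 * Real.pi * l / q) with hT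
  have hTsum : HasSum T (∑ l ∈ Finset.range q, Ck.lacunary k Q (x + 2 * Real.pi * l / q)) :=
    hasSum_sum fun l _ => Ck.hasSum_lacunary_apply hk Q _
  have hTi : ∀ i, T i = (1 / 2 : ℝ) ^ i * ((((i + 1) * Q i : ℕ) : ℝ) ^ k)⁻¹ *
      if q ∣ (i + 1) * Q i then q * Real.cos (((i + 1) * Q i : ℕ) * x) else 0 := by
    intro i
    rw [hT, ← sum_cos_eq (hQpos j), Finset.mul_sum]
    refine Finset.sum_congr rfl fun l _ => ?_
    rw [Ck.harmonic_apply, ← mul_assoc]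
  have hfirst : ∑ i ∈ Finset.range (j + 1), T i =
      q * (A * Real.cos (((j + 1) * q : ℕ) * x)) := by
    rw [Finset.sum_range_succ, Finset.sum_eq_zero, zero_add, hTi, if_pos (Dvd.intro_left _ rfl)]
    · ring
    · intro i hi
      have h1 := mul_le_of_mem_block hQ (Finset.mem_range.1 hi)
      have h2 : 0 < (i + 1) * Q i := Nat.mul_pos i.succ_pos (hQpos i)
      rw [hTi, if_neg fun hdvd => ?_, mul_zero]
      have h3 := Nat.le_of_dvd h2 hdvd
      omega
  have htail := (hasSum_nat_add_iff' (j + 1)).2 hTsum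
  rw [hfirst] at htail
  have hgeom := hasSum_geometric_two' (q * A / 8)
  refine htail.norm_le_of_bounded hgeom fun i => ?_
  have h1 := mul_le_of_mem_block hQ (show j < i + (j + 1) by omega)
  set M := (i + (j + 1) + 1) * Q (i + (j + 1)) with hM
  have h2 : 8 * ((j + 1) * q) ≤ M := h1.trans (Nat.le_mul_of_pos_left _ (by omega))
  have h3 : (8 : ℝ) * (((j + 1) * q : ℕ) : ℝ) ≤ M := by exact_mod_cast h2
  have h4 : ((M : ℝ) ^ k)⁻¹ ≤ ((((j + 1) * q : ℕ) : ℝ) ^ k)⁻¹ / 8 := by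
    rw [← one_div, ← one_div, div_div]
    refine one_div_le_one_div_of_le (by positivity) ?_
    calc (((j + 1) * q : ℕ) : ℝ) ^ k * 8 ≤ (((j + 1) * q : ℕ) : ℝ) ^ k * 8 ^ k := by
          have : (8 : ℝ) ≤ 8 ^ k := le_self_pow₀ (by norm_num) (by omega)
          gcongr
      _ = (8 * (((j + 1) * q : ℕ) : ℝ)) ^ k := by rw [mul_pow]; ring
      _ ≤ (M : ℝ) ^ k := by gcongr
  have h5 : |if q ∣ M then (q : ℝ) * Real.cos (M * x) else 0| ≤ q := by
    split_ifs
    · rw [abs_mul, abs_of_pos hq0]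
      exact mul_le_of_le_one_right hq0.le (Real.abs_cos_le_one _)
    · rw [abs_zero]
      exact hq0.le
  rw [hTi, Real.norm_eq_abs, abs_mul, abs_of_nonneg (by positivity)]
  calc (1 / 2 : ℝ) ^ (i + (j + 1)) * ((M : ℝ) ^ k)⁻¹ *
        |if q ∣ M then (q : ℝ) * Real.cos (M * x) else 0|
      ≤ (1 / 2 : ℝ) ^ (i + (j + 1)) * (((((j + 1) * q : ℕ) : ℝ) ^ k)⁻¹ / 8) * q := by gcongr
    _ = q * A / 8 / 2 / 2 ^ i := by
      rw [hA, pow_add, pow_succ, div_pow, one_pow]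
      field_simp

theorem not_cyclicityAt_lacunary_le {k : ℕ} (hk : 1 ≤ k) {Q : ℕ → ℕ}
    (hQ : ∀ i, Q i ∈ Set.Ico (blockStart i) (2 * blockStart i)) (g : Ck k) (j : ℕ) (m₀ : ℝ)
    (hg : ∀ x, (Q j : ℝ) ^ k *
      |(∑ l ∈ Finset.range (Q j), g (x + 2 * Real.pi * l / Q j)) / Q j - m₀| ≤
        (1 / 2) ^ j * (((j + 1 : ℕ) : ℝ) ^ k)⁻¹ / 4) :
    ¬ cyclicityAt (family (g + Ck.lacunary k Q)) (1 / Q j) ≤ (j : ℕ∞) := by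
  have hlac := sum_translates_lacunary hk hQ j
  have hQpos : 0 < Q j := (blockStart_pos j).trans_le (hQ j).1
  set q := Q j with hq
  set A : ℝ := (1 / 2) ^ j * ((((j + 1) * q : ℕ) : ℝ) ^ k)⁻¹ with hA
  have hpi := Real.pi_pos
  have hq0 : (0 : ℝ) < q := by exact_mod_cast hQpos
  set M : ℝ := (((j + 1) * q : ℕ) : ℝ) with hM
  have hM0 : (0 : ℝ) < M := by
    rw [hM]
    exact_mod_cast Nat.mul_pos j.succ_pos hQpos
  have hMq : M = (j + 1) * q := by
    rw [hM]
    push_cast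
    ring
  have hqA : 0 < q * A := by positivity
  have hg' : ∀ x, |∑ l ∈ Finset.range q, g (x + 2 * Real.pi * l / q) - q * m₀| ≤ q * A / 4 := by
    intro x
    have h1 := hg x
    rw [← le_div_iff₀' (by positivity)] at h1
    have h2 : ∑ l ∈ Finset.range q, g (x + 2 * Real.pi * l / q) - q * m₀ =
        q * ((∑ l ∈ Finset.range q, g (x + 2 * Real.pi * l / q)) / q - m₀) := by
      field_simp
    rw [h2, abs_mul, abs_of_pos hq0]
    refine (mul_le_mul_of_nonneg_left h1 hq0.le).trans (le_of_eq ?_)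
    rw [hA, hMq, mul_pow]
    push_cast
    field_simp
  have hsum : ∀ x, |∑ l ∈ Finset.range q, (g + Ck.lacunary k Q) (x + 2 * Real.pi * l / q) -
      (q * m₀ + q * A * Real.cos (M * x))| ≤ q * A / 2 := by
    intro x
    have h1 : ∑ l ∈ Finset.range q, (g + Ck.lacunary k Q) (x + 2 * Real.pi * l / q) =
        ∑ l ∈ Finset.range q, g (x + 2 * Real.pi * l / q) +
        ∑ l ∈ Finset.range q, Ck.lacunary k Q (x + 2 * Real.pi * l / q) :=
      Finset.sum_add_distrib
    rw [h1]
    have h2 := abs_le.1 (hg' x)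
    have h3 := abs_le.1 (hlac x)
    rw [abs_le]
    constructor <;> linarith [h2.1, h2.2, h3.1, h3.2]
  -- The endpoints are consecutive maxima and minima of `cos(Mx)`. The errors `1/4` from `g` and
  -- `1/8` from the other harmonics stay below the amplitude `1`, so the signs survive.
  refine not_cyclicityAt_le hk _ j hQpos m₀ (fun i => 2 * Real.pi * i / M)
    (fun i => (2 * Real.pi * i + Real.pi) / M) ?_ ?_ ?_ ?_ ?_
  · intro i
    exact div_lt_div_of_pos_right (by linarith) hM0
  · intro i i' hii
    have h1 : ((i : ℕ) : ℝ) + 1 ≤ ((i' : ℕ) : ℝ) := by exact_mod_cast hii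
    exact div_lt_div_of_pos_right (by nlinarith) hM0
  · intro i i'
    have h1 : ((i' : ℕ) : ℝ) ≤ j := by exact_mod_cast Nat.lt_succ_iff.1 i'.2
    have h2 : (0 : ℝ) ≤ ((i : ℕ) : ℝ) := Nat.cast_nonneg _
    rw [← sub_div, div_lt_div_iff₀ hM0 hq0, hMq]
    have h3 : 2 * Real.pi * (i' : ℕ) + Real.pi - 2 * Real.pi * (i : ℕ) < 2 * Real.pi * (j + 1) := by
      nlinarith
    nlinarith
  · intro i
    have h1 := (abs_le.1 (hsum (2 * Real.pi * i / M))).1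
    have h2 : Real.cos (M * (2 * Real.pi * i / M)) = 1 := by
      rw [mul_div_cancel₀ _ hM0.ne', mul_comm]
      exact Real.cos_nat_mul_two_pi i
    rw [h2] at h1
    linarith
  · intro i
    have h1 := (abs_le.1 (hsum ((2 * Real.pi * i + Real.pi) / M))).2
    have h2 : Real.cos (M * ((2 * Real.pi * i + Real.pi) / M)) = -1 := by
      rw [mul_div_cancel₀ _ hM0.ne', mul_comm, Real.cos_add_pi, Real.cos_nat_mul_two_pi]
    rw [h2] at h1
    linarith

/-! ### Random frequencies and the null event. -/

section Random

/-- The uniformly distributed frequencies in the blocks, driven by `ω ∈ [0, 1)`. -/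
def frequency (ω : ℝ) (i : ℕ) : ℕ := blockStart i + ⌊blockStart i * ω⌋₊

theorem frequency_mem {ω : ℝ} (hω : ω ∈ Set.Ico (0 : ℝ) 1) (i : ℕ) :
    frequency ω i ∈ Set.Ico (blockStart i) (2 * blockStart i) := by
  have hb : (0 : ℝ) < blockStart i := by exact_mod_cast blockStart_pos i
  have h1 : ⌊blockStart i * ω⌋₊ < blockStart i := by
    rw [Nat.floor_lt (mul_nonneg hb.le hω.1)]
    exact mul_lt_of_lt_one_right hb hω.2
  unfold frequency
  exact ⟨by omega, by omega⟩

theorem measurable_frequency (i : ℕ) : Measurable fun ω => frequency ω i := by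
  unfold frequency
  exact (measurable_const_mul _).nat_floor.const_add _

theorem volume_frequency_le (B : Finset ℕ) (i : ℕ) :
    volume {ω : ℝ | ω ∈ Set.Ico (0 : ℝ) 1 ∧ frequency ω i ∈ B} ≤
      ENNReal.ofReal (B.card / blockStart i) := by
  have hb : (0 : ℝ) < blockStart i := by exact_mod_cast blockStart_pos i
  have hsub : {ω : ℝ | ω ∈ Set.Ico (0 : ℝ) 1 ∧ frequency ω i ∈ B} ⊆
      ⋃ q ∈ B, Set.Ico (((q : ℝ) - blockStart i) / blockStart i)
        (((q : ℝ) - blockStart i + 1) / blockStart i) := by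
    rintro ω ⟨hω, hB⟩
    refine Set.mem_biUnion hB ⟨?_, ?_⟩
    · rw [div_le_iff₀ hb]
      have h1 := Nat.floor_le (mul_nonneg hb.le hω.1)
      unfold frequency
      push_cast
      linarith
    · rw [lt_div_iff₀ hb]
      have h1 := Nat.lt_floor_add_one ((blockStart i : ℝ) * ω)
      unfold frequency
      push_cast
      linarith
  refine (measure_mono hsub).trans ((measure_biUnion_finset_le B _).trans ?_)
  simp only [Real.volume_Ico, ← sub_div, add_sub_cancel_left]
  rw [Finset.sum_const, nsmul_eq_mul, ← ENNReal.ofReal_natCast,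
    ← ENNReal.ofReal_mul (Nat.cast_nonneg _), mul_one_div]

/-- Each partial sum depends on finitely many integer-valued measurable functions of `ω`, hence is
strongly measurable, and the series converges for every `ω`. -/
theorem measurable_lacunary {k : ℕ} (hk : 1 ≤ k) :
    Measurable fun ω : ℝ => Ck.lacunary k (frequency ω) := by
  have h1 : ∀ n, StronglyMeasurable fun ω : ℝ => ∑ i ∈ Finset.range n,
      (1 / 2 : ℝ) ^ i • Ck.harmonic k ((i + 1) * frequency ω i) := fun n =>
    Finset.stronglyMeasurable_fun_sum _ fun i _ =>
      (StronglyMeasurable.of_discrete (f := fun q : ℕ =>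
        (1 / 2 : ℝ) ^ i • Ck.harmonic k ((i + 1) * q))).comp_measurable (measurable_frequency i)
  refine (stronglyMeasurable_of_tendsto atTop h1 ?_).measurable
  rw [tendsto_pi_nhds]
  exact fun ω => (Ck.summable_lacunary hk (frequency ω)).hasSum.tendsto_sum_nat

/-- The number of bad frequencies is of order `4^j (j + 1)^(2k)`, against a block of length `16^j
j!`. -/
theorem tendsto_bad_bound (k : ℕ) (K : ℝ) :
    Tendsto (fun j : ℕ => K / ((1 / 2) ^ j * (((j + 1 : ℕ) : ℝ) ^ k)⁻¹ / 4) ^ 2 / blockStart j)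
      atTop (𝓝 0) := by
  have h1 : Tendsto (fun j : ℕ => ((j + 1 : ℕ) : ℝ) ^ (2 * k) * (1 / 4 : ℝ) ^ (j + 1)) atTop (𝓝 0) :=
    (tendsto_pow_const_mul_const_pow_of_abs_lt_one (2 * k)
      (by rw [abs_of_pos] <;> norm_num : |(1 / 4 : ℝ)| < 1)).comp (tendsto_add_atTop_nat 1)
  have h2 : Tendsto (fun j : ℕ => |K| * 64 *
      (((j + 1 : ℕ) : ℝ) ^ (2 * k) * (1 / 4 : ℝ) ^ (j + 1))) atTop (𝓝 0) := by
    simpa using h1.const_mul (|K| * 64)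
  refine squeeze_zero_norm (fun j => ?_) h2
  have hf : (1 : ℝ) ≤ j.factorial := by exact_mod_cast j.factorial_pos
  have h3 : K / ((1 / 2) ^ j * (((j + 1 : ℕ) : ℝ) ^ k)⁻¹ / 4) ^ 2 / blockStart j =
      K * 64 * (((j + 1 : ℕ) : ℝ) ^ (2 * k) * (1 / 4 : ℝ) ^ (j + 1)) / j.factorial := by
    have h4 : (16 : ℝ) ^ j = 4 ^ j * (2 ^ j) ^ 2 := by
      rw [← pow_mul, mul_comm j 2, pow_mul, ← mul_pow]
      norm_num
    unfold blockStart
    push_cast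
    rw [h4, mul_comm 2 k, pow_mul]
    simp only [div_pow, one_pow, pow_succ (4 : ℝ)]
    field_simp
    ring
  rw [h3, norm_div, norm_mul, norm_mul]
  rw [Real.norm_of_nonneg (show (0 : ℝ) ≤ 64 by norm_num),
    Real.norm_of_nonneg (show (0 : ℝ) ≤ _ * _ by positivity), Real.norm_eq_abs,
    Real.norm_of_nonneg (show (0 : ℝ) ≤ j.factorial by positivity)]
  exact div_le_self (by positivity) hf

/-- Cyclicity at most `N` forces the frequency `Qⱼ` to be bad for `g` for every `j ≥ N`. The event
is thus contained in events of probability tending to `0`; no independence between blocks is needed.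
-/
theorem volume_icBounded_eq_zero {k : ℕ} (hk : 2 ≤ k) (g : Ck k) (N : ℕ) :
    volume {ω : ℝ | ω ∈ Set.Ico (0 : ℝ) 1 ∧ g + Ck.lacunary k (frequency ω) ∈ ICBounded k N} = 0 := by
  classical
  obtain ⟨m₀, K, hK⟩ := exists_card_le hk g
  set η : ℕ → ℝ := fun j => (1 / 2) ^ j * (((j + 1 : ℕ) : ℝ) ^ k)⁻¹ / 4 with hη
  have hη0 : ∀ j, 0 < η j := fun j => by positivity
  set B : ℕ → Finset ℕ := fun j =>
    (Finset.Ico (blockStart j) (2 * blockStart j)).filter fun q => ∃ x, η j < (q : ℝ) ^ k *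
      |(∑ l ∈ Finset.range q, g (x + 2 * Real.pi * l / q)) / q - m₀| with hB
  have hcard : ∀ j, ((B j).card : ℝ) / blockStart j ≤ K / (η j) ^ 2 / blockStart j := fun j => by
    refine div_le_div_of_nonneg_right ?_ (Nat.cast_nonneg _)
    rw [le_div_iff₀ (pow_pos (hη0 j) 2)]
    refine hK (η j) (hη0 j).le (B j) fun q hq => ?_
    rw [hB, Finset.mem_filter, Finset.mem_Ico] at hq
    exact ⟨(blockStart_pos j).trans_le hq.1.1, hq.2⟩
  have hsub : ∀ j, N ≤ j →
      {ω : ℝ | ω ∈ Set.Ico (0 : ℝ) 1 ∧ g + Ck.lacunary k (frequency ω) ∈ ICBounded k N} ⊆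
      {ω : ℝ | ω ∈ Set.Ico (0 : ℝ) 1 ∧ frequency ω j ∈ B j} := by
    rintro j hj ω ⟨hω, hmem⟩
    refine ⟨hω, ?_⟩
    by_contra hnot
    have hQ := frequency_mem hω
    refine not_cyclicityAt_lacunary_le (by omega) hQ g j m₀ (fun x => ?_)
      ((hmem (1 / frequency ω j)).trans (by exact_mod_cast hj))
    by_contra hx
    exact hnot (Finset.mem_filter.2 ⟨Finset.mem_Ico.2 (hQ j), x, not_le.1 hx⟩)
  have hlim : Tendsto (fun j => ENNReal.ofReal (K / (η j) ^ 2 / blockStart j)) atTop (𝓝 0) := by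
    have := ENNReal.tendsto_ofReal (tendsto_bad_bound k K)
    rwa [ENNReal.ofReal_zero] at this
  refine le_antisymm (ge_of_tendsto hlim ?_) zero_le
  filter_upwards [eventually_ge_atTop N] with j hj
  exact (measure_mono (hsub j hj)).trans ((volume_frequency_le (B j) j).trans
    (ENNReal.ofReal_le_ofReal (hcard j)))

end Random

/-! ### Conclusion. -/

theorem isHaarPrevalent_ICInf {k : ℕ} (hk : 2 ≤ k) : IsHaarPrevalent (ICInf k) := by
  unfold IsHaarPrevalent ICInf
  rw [compl_compl]
  have hmeas := measurableSet_ICFin (k := k) (by omega)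
  have hΦ := measurable_lacunary (k := k) (by omega)
  have hprob : IsProbabilityMeasure (volume.restrict (Set.Ico (0 : ℝ) 1)) :=
    ⟨by simp⟩
  refine ⟨hmeas, (volume.restrict (Set.Ico (0 : ℝ) 1)).map
    (fun ω => Ck.lacunary k (frequency ω)), Measure.isProbabilityMeasure_map hΦ.aemeasurable,
    fun x => ?_⟩
  -- A translate by `x` is the preimage under adding `-x`, so the fixed perturbation is `g = -x`.
  have himg : (fun y => x + y) '' ICFin k = (fun y => -x + y) ⁻¹' ICFin k :=
    Set.image_add_left
  have hm : MeasurableSet ((fun y => -x + y) ⁻¹' ICFin k) :=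
    hmeas.preimage (continuous_const.add continuous_id).measurable
  rw [himg, Measure.map_apply hΦ hm, Measure.restrict_apply (hΦ hm)]
  refine measure_mono_null (t := ⋃ N : ℕ, {ω : ℝ | ω ∈ Set.Ico (0 : ℝ) 1 ∧
    -x + Ck.lacunary k (frequency ω) ∈ ICBounded k N}) ?_
    (measure_iUnion_null fun N => volume_icBounded_eq_zero hk (-x) N)
  rintro ω ⟨h1, h2⟩
  obtain ⟨N, hN⟩ := Set.mem_iUnion.1 (show _ ∈ ICFin k from h1)
  exact Set.mem_iUnion.2 ⟨N, h2, hN⟩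

end

end CircleFamily

theorem mainTheorem3 (k : ℕ) (hk : 2 ≤ k) :
    CircleFamily.IsHaarPrevalent (CircleFamily.ICInf k) :=
  CircleFamily.isHaarPrevalent_ICInf hk
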